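/- **Setting.** Let $M$ and $\bar M$ be $n$-dimensional smooth Riemannian manifolds, $\Omega\subset M$ and $\bar\Omega\subset\bar M$ bounded domains (nonempty, open, connected), and $c:\Omega\times\bar\Omega\to\mathbb R$ a cost function. Let $D$, $\bar D$ denote the differentials in the first and second variable. Let $\mu$, $\nu$ be Borel probability measures on $M$, $\bar M$ with $\operatorname{spt}\mu\subset\Omega$, $\operatorname{spt}\nu\subset\bar\Omega$ and $\operatorname{spt}\nu$ compact (automatic if $\bar M$ is complete). **Definitions.** - $c$ is *twisted* if $\bar\Omega\ni\bar x\mapsto -Dc(x_0,\bar x)\in T^*_{x_0}M$ and $\Omega\ni x\mapsto-\bar Dc(x,\bar x_0)\in T^*_{\bar x_0}\bar M$ are injective for all $x_0\in\Omega$, $\bar x_0\in\bar\Omega$. The inverse of the first map is denoted $\text{c-Exp}_{x_0}$; it is defined on $-Dc(x_0,\bar\Omega)$. - A set $\bar A\subset\bar\Omega$ is *$c$-convex with respect to* $x\in\Omega$ if $-Dc(x,\bar A)$ is convex; $A\subset\Omega$ is $c$-convex with respect to $\bar x\in\bar\Omega$ if $-\bar Dc(A,\bar x)$ is convex. $\Omega$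 and $\bar\Omega$ are *mutually $c$-convex* if $\Omega$ is $c$-convex with respect to every $\bar x\in\bar\Omega$ and $\bar\Omega$ with respect to every $x\in\Omega$. - A function $u$ on a set $U\subset\Omega$ is *$c$-convex* if for every $x_0\in U$ there are $\bar x_0\in\bar\Omega$, $\lambda_0\in\mathbb R$ with $-c(x_0,\bar x_0)+\lambda_0=u(x_0)$ and $-c(x,\bar x_0)+\lambda_0\le u(x)$ for all $x\in U$. - A *Brenier solution* pushing $\mu$ forward to $\nu$ is a $c$-convex function $u$ on some $U$ with $\operatorname{spt}\mu\subset U\subset\Omega$ such that $\mu$-a.e. point is an interior point of $U$ where $u$ is differentiable, and such that $T(x)=\text{c-Exp}_x(Du(x))$ satisfies $T_\#\mu=\nu$ and $T(x)\in\operatorname{spt}\nu$ for every $x\in\operatorname{spt}\mu\cap U^{\mathrm{int}}$ where $u$ is differentiable. - The *subdifferential* $\partial u(x)$ is the set of $p\in T_x^*M$ with $u(x)+\langle v,p\rangle+o(|v|)\le u(\exp_x v)$ as $T_xM\ni v\to0$. - $x_0$ is an *isolated singular point* of $u$ if $u$ is not differentiable at $x_0$ but is differentiable at all other points of some neighbourhood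 of $x_0$. - A *hole* in $A\subset\bar M$ is a nonempty, bounded, open, connected set $\mathcal O\subset\bar M$ with $\mathcal O\cap A^{\mathrm{int}}=\emptyset$ and $\partial\mathcal O\subset\partial A$. - (A0): $c\in C^4(\overline{\Omega}\times\overline{\bar\Omega})$. Nondegeneracy: the linear map $-\bar DDc(x,\bar x):T_{\bar x}\bar M\to T_x^*M$ is invertible for all $(x,\bar x)\in\Omega\times\bar\Omega$. MTW: in local coordinates, for all $(x,\bar x)\in\Omega\times\bar\Omega$ and all $V\in T_xM$, $\eta\in T^*_xM$ with $\eta(V)=0$, $$\bigl(c_{ij,p}\,c^{p,q}\,c_{q,rs}-c_{ij,rs}\bigr)c^{r,k}c^{s,l}\,V^iV^j\eta_k\eta_l\ \ge 0,$$ where indices before (after) the comma denote derivatives in the first (second) variable and $(c^{p,q})$ is the inverse of the matrix $(c_{q,p})$. **Proposition.** Suppose $c$ is $C^1$ on $\Omega\times\bar\Omega$ and twisted, and $u$ is a Brenier solution pushing $\mu$ forward to $\nu$. 1. If $\operatorname{spt}\nu$ has no holes, then $u$ has no isolated singular point $x_0\in(\operatorname{spt}\mu)^{\mathrm{int}}$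 such that $\partial u(x_0)$ has affine dimension $n$ and $\text{c-Exp}_{x_0}$ is defined on the interior of $\partial u(x_0)$, i.e. $(\partial u(x_0))^{\mathrm{int}}\subset-Dc(x_0,\bar\Omega)$. 2. If in addition $c$ satisfies (A0), nondegeneracy and MTW, and $\Omega$ and $\bar\Omega$ are mutually $c$-convex, then $u$ has no isolated singular point $x_0\in(\operatorname{spt}\mu)^{\mathrm{int}}$ such that $\partial u(x_0)$ has affine dimension $n$ and $\operatorname{spt}\nu$ has no hole that is $c$-convex with respect to $x_0$. -/

import Mathlib

open Set Filter Topology MeasureTheory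
open scoped Manifold ContDiff Bundle

noncomputable section

namespace OptTrans

/-- Covectors. In Mathlib the tangent space `TangentSpace (𝓡 n) x` of an `n`-dimensional manifold
is by definition the model space, the identification being the derivative at `x` of the preferred
chart at `x`. So `Covec n` is the cotangent space at each point. -/
abbrev Covec (n : ℕ) : Type := EuclideanSpace ℝ (Fin n) →L[ℝ] ℝ

section Cost

variable (n : ℕ) {M N : Type*}
  [TopologicalSpace M] [ChartedSpace (EuclideanSpace ℝ (Fin n)) M]
  [TopologicalSpace N] [ChartedSpace (EuclideanSpace ℝ (Fin n)) N]

/-- The differential `Du(x)` of a real function, as a covector at `x`. -/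
def diff (u : M → ℝ) (x : M) : Covec n := mvfderiv (𝓡 n) u x

/-- The covector `-Dc(x, y)` at `x` (derivative in the first variable). -/
def negD (c : M → N → ℝ) (x : M) (y : N) : Covec n := -diff n (fun x' => c x' y) x

/-- The covector `-D̄c(x, y)` at `y` (derivative in the second variable). -/
def negDbar (c : M → N → ℝ) (x : M) (y : N) : Covec n := -diff n (fun y' => c x y') y

/-- The cost is `C^1` on `Ω × Ω'`. -/
def CostC1 (c : M → N → ℝ) (Ω : Set M) (Ω' : Set N) : Prop :=
  ContMDiffOn ((𝓡 n).prod (𝓡 n)) 𝓘(ℝ, ℝ) 1 (Function.uncurry c) (Ω ×ˢ Ω')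

/-- Condition (A0): the cost is `C^4` on the product of the closures of `Ω` and `Ω'`. -/
def CostA0 (c : M → N → ℝ) (Ω : Set M) (Ω' : Set N) : Prop :=
  ContMDiffOn ((𝓡 n).prod (𝓡 n)) 𝓘(ℝ, ℝ) 4 (Function.uncurry c) (closure Ω ×ˢ closure Ω')

/-- The twist condition. -/
def Twist (c : M → N → ℝ) (Ω : Set M) (Ω' : Set N) : Prop :=
  (∀ x ∈ Ω, InjOn (fun y => negD n c x y) Ω') ∧
    (∀ y ∈ Ω', InjOn (fun x => negDbar n c x y) Ω)

/-- The `c`-exponential map at `x`: the inverse of `Ω' ∋ y ↦ -Dc(x, y)`; it is defined on the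
image `-Dc(x, Ω')` and has a junk value outside of this image. -/
def cExp [Nonempty N] (c : M → N → ℝ) (Ω' : Set N) (x : M) (p : Covec n) : N :=
  Function.invFunOn (fun y => negD n c x y) Ω' p

/-- `A ⊆ Ω` is `c`-convex with respect to `y`. -/
def CConvexSource (c : M → N → ℝ) (Ω : Set M) (y : N) (A : Set M) : Prop :=
  A ⊆ Ω ∧ Convex ℝ ((fun x => negDbar n c x y) '' A)

/-- `A ⊆ Ω'` is `c`-convex with respect to `x`. -/
def CConvexTarget (c : M → N → ℝ) (Ω' : Set N) (x : M) (A : Set N) : Prop :=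
  A ⊆ Ω' ∧ Convex ℝ ((fun y => negD n c x y) '' A)

/-- `Ω` and `Ω'` are `c`-convex with respect to each other. -/
def MutuallyCConvex (c : M → N → ℝ) (Ω : Set M) (Ω' : Set N) : Prop :=
  (∀ y ∈ Ω', CConvexSource n c Ω y Ω) ∧ (∀ x ∈ Ω, CConvexTarget n c Ω' x Ω')

/-- Nondegeneracy: for `x ∈ Ω` and `y ∈ Ω'` the derivative at `y` of the map
`y' ↦ -Dc(x, y')`, which takes values in the fixed vector space of covectors at `x`,
is invertible. -/
def Nondegenerate (c : M → N → ℝ) (Ω : Set M) (Ω' : Set N) : Prop :=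
  ∀ x ∈ Ω, ∀ y ∈ Ω', Function.Bijective (mvfderiv (𝓡 n) (fun y' => negD n c x y') y)

/-- The cost in the preferred charts at `x` and `y`. -/
def localCost (c : M → N → ℝ) (x : M) (y : N) (a b : EuclideanSpace ℝ (Fin n)) : ℝ :=
  c ((extChartAt (𝓡 n) x).symm a) ((extChartAt (𝓡 n) y).symm b)

variable {n} in
/-- Partial derivative of `C(a, b)` with respect to the `i`-th coordinate of `a`. -/
def dFst (i : Fin n) (C : EuclideanSpace ℝ (Fin n) → EuclideanSpace ℝ (Fin n) → ℝ)
    (a b : EuclideanSpace ℝ (Fin n)) : ℝ :=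
  fderiv ℝ (fun a' => C a' b) a (EuclideanSpace.single i 1)

variable {n} in
/-- Partial derivative of `C(a, b)` with respect to the `r`-th coordinate of `b`. -/
def dSnd (r : Fin n) (C : EuclideanSpace ℝ (Fin n) → EuclideanSpace ℝ (Fin n) → ℝ)
    (a b : EuclideanSpace ℝ (Fin n)) : ℝ :=
  fderiv ℝ (fun b' => C a b') b (EuclideanSpace.single r 1)

variable {n} in
/-- The matrix `c_{i,r}` of mixed second derivatives (row: first variable, column: second). -/
def mixedHessian (C : EuclideanSpace ℝ (Fin n) → EuclideanSpace ℝ (Fin n) → ℝ)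
    (a b : EuclideanSpace ℝ (Fin n)) : Matrix (Fin n) (Fin n) ℝ :=
  Matrix.of fun i r => dSnd r (dFst i C) a b

variable {n} in
/-- The Ma-Trudinger-Wang tensor in coordinates,
`MTW_{ij}^{kl} = ∑_{r,s} (∑_{p,q} c_{ij,p} c^{p,q} c_{q,rs} - c_{ij,rs}) c^{r,k} c^{s,l}`,
where indices before (after) the comma denote derivatives in the first (second) variable and
`c^{p,q}` is the inverse of the matrix `c_{q,p}`. -/
def mtwCoord (C : EuclideanSpace ℝ (Fin n) → EuclideanSpace ℝ (Fin n) → ℝ)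
    (a b : EuclideanSpace ℝ (Fin n)) (i j k l : Fin n) : ℝ :=
  ∑ r, ∑ s,
    ((∑ p, ∑ q, dSnd p (dFst j (dFst i C)) a b * (mixedHessian C a b)⁻¹ p q *
        dSnd s (dSnd r (dFst q C)) a b) -
      dSnd s (dSnd r (dFst j (dFst i C))) a b) *
    (mixedHessian C a b)⁻¹ r k * (mixedHessian C a b)⁻¹ s l

/-- The (weak) Ma-Trudinger-Wang condition, with `V` and `η` the coordinates of a tangent vector
and of a covector at `x` that annihilate each other. -/
def MTW (c : M → N → ℝ) (Ω : Set M) (Ω' : Set N) : Prop :=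
  ∀ x ∈ Ω, ∀ y ∈ Ω', ∀ V η : Fin n → ℝ, ∑ i, η i * V i = 0 →
    0 ≤ ∑ i, ∑ j, ∑ k, ∑ l,
      mtwCoord (localCost n c x y) (extChartAt (𝓡 n) x x) (extChartAt (𝓡 n) y y) i j k l *
        V i * V j * η k * η l

/-- The function `u` with domain `D` is `c`-convex: at each point of `D` it is supported from
below by a `c`-affine function with focus in `Ω'`. -/
def CConvexFun (c : M → N → ℝ) (D : Set M) (Ω' : Set N) (u : M → ℝ) : Prop :=
  ∀ x₀ ∈ D, ∃ y₀ ∈ Ω', ∃ lam : ℝ,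
    -c x₀ y₀ + lam = u x₀ ∧ ∀ x ∈ D, -c x y₀ + lam ≤ u x

/-- The subdifferential of `u` at `x`: the covectors `p` at `x` with
`u(x) + p(v) + o(‖v‖) ≤ u(y)` as `y → x`, where `v` is `y - x` read in the preferred chart at `x`.
As a chart and the inverse of the exponential map at `x` agree to first order at `x`, this is
the usual definition by means of the exponential map. -/
def subdiff (u : M → ℝ) (x : M) : Set (Covec n) :=
  {p | ∀ ε > 0, ∀ᶠ y in 𝓝 x,
    u x + p (extChartAt (𝓡 n) x y - extChartAt (𝓡 n) x x)
      - ε * ‖extChartAt (𝓡 n) x y - extChartAt (𝓡 n) x x‖ ≤ u y}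

/-- `u` is not differentiable at `x₀`, but it is at all other points of a neighbourhood. -/
def IsIsolatedSingularPoint (u : M → ℝ) (x₀ : M) : Prop :=
  ¬ MDifferentiableAt (𝓡 n) 𝓘(ℝ, ℝ) u x₀ ∧
    ∀ᶠ x in 𝓝[≠] x₀, MDifferentiableAt (𝓡 n) 𝓘(ℝ, ℝ) u x

/-- The Brenier map `T(x) = cExp_x(Du(x))`. -/
def brenierMap [Nonempty N] (c : M → N → ℝ) (Ω' : Set N) (u : M → ℝ) (x : M) : N :=
  cExp n c Ω' x (diff n u x)

/-- The function `u` with domain `D` is a Brenier solution pushing `μ` forward to `ν`. The Brenier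
map `T` has to be defined `μ`-almost everywhere: almost every point is an interior point of `D`
at which `u` is differentiable. At each such point in the support of `μ`, the value of `T` lies
in the support of `ν`. -/
structure IsBrenierSolution [Nonempty N] [MeasurableSpace M] [MeasurableSpace N]
    (c : M → N → ℝ) (D : Set M) (Ω' : Set N) (μ : Measure M) (ν : Measure N) (u : M → ℝ) :
    Prop where
  cConvex : CConvexFun c D Ω' u
  support_subset : μ.support ⊆ D
  ae_differentiable : ∀ᵐ x ∂μ, x ∈ interior D ∧ MDifferentiableAt (𝓡 n) 𝓘(ℝ, ℝ) u x
  aemeasurable : AEMeasurable (brenierMap n c Ω' u) μ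
  map_eq : μ.map (brenierMap n c Ω' u) = ν
  mapsTo : ∀ x ∈ μ.support, x ∈ interior D → MDifferentiableAt (𝓡 n) 𝓘(ℝ, ℝ) u x →
    brenierMap n c Ω' u x ∈ ν.support

end Cost

/-- A domain: a nonempty connected open set. -/
def IsDomainSet {X : Type*} [TopologicalSpace X] (A : Set X) : Prop := IsOpen A ∧ IsConnected A

/-- Bounded sets of an extended metric space. -/
def IsBoundedSet {X : Type*} [PseudoEMetricSpace X] (A : Set X) : Prop := Metric.ediam A ≠ ⊤

/-- `O` is a hole in `A`. -/
structure IsHole {X : Type*} [PseudoEMetricSpace X] (A O : Set X) : Prop where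
  nonempty : O.Nonempty
  bounded : IsBoundedSet O
  isOpen : IsOpen O
  isConnected : IsConnected O
  inter_interior : O ∩ interior A = ∅
  frontier_subset : frontier O ⊆ frontier A

/-- The dimension of the affine hull of a set. -/
def affDim {V : Type*} [AddCommGroup V] [Module ℝ V] (K : Set V) : ℕ :=
  Module.finrank ℝ (vectorSpan ℝ K)

end OptTrans

end

namespace OptTrans

/-! Let x₀ be an isolated singular point and K the subdifferential of u there, a convex set with
nonempty interior. At every nearby x ≠ x₀ the function u is differentiable and has a supporting
function with focus T(x) in the compact set spt ν. A boundary point p of K maximizes some v ≠ 0 over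
K. Close to the ray from x₀ in direction v there are points with Du near p, and a limit of their
foci is a y in spt ν that supports u at x₀ and satisfies -Dc(x₀, y) = p (`exists_negD_eq`,
`frontier_subdiff_subset`). So c-Exp maps ∂K into spt ν.

The interior of K behaves in the opposite way (`notMem_cSubdiff`). For x ≠ x₀ in the domain of u,
the function z ↦ c(x, z) - c(x₀, z) attains its minimum over c-Exp(K), and twist in the second
variable excludes local minima over the interior of K. The minimum therefore sits strictly lower, at
a focus over ∂K, which supports u at x₀. This is incompatible with a focus over the interior
supporting u at x. Hence T avoids O = c-Exp(int K) almost everywhere, so ν(O) = 0. The set O is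
open, connected, disjoint from spt ν and has its boundary in c-Exp(∂K) ⊆ spt ν: it is a hole
(`isHole`), and it is c-convex with respect to x₀ because its image is int K. In the second part K
lies in the domain of c-Exp because -Dc(x₀, Ω') is convex and contains ∂K
(`subset_of_frontier_subset`).

As c is only C¹, the map y ↦ -Dc(x₀, y) is merely continuous and injective, and continuity of its
inverse rests on invariance of domain. This is derived from a zero theorem for compactly supported
perturbations of the identity, which in turn follows from a change of variables whose integrand is
polynomial in the deformation parameter. -/

theorem exists_polynomial_one_sub_norm_sq_pow {E : Type*} [NormedAddCommGroup E]
    [InnerProductSpace ℝ E] (r : ℝ) (k : ℕ) (x v : E) :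
    ∃ p : Polynomial ℝ, p.natDegree ≤ 2 * k ∧
      ∀ t : ℝ, p.eval t = (1 - r * ‖x + t • v‖ ^ 2) ^ k := by
  have hq : ∀ a b c : ℝ, ∃ p : Polynomial ℝ, p.natDegree ≤ 2 * k ∧
      ∀ t : ℝ, p.eval t = (a * t ^ 2 + b * t + c) ^ k := fun a b c => by
    refine ⟨(Polynomial.C a * Polynomial.X ^ 2 + Polynomial.C b * Polynomial.X
      + Polynomial.C c) ^ k, ?_, fun t => by simp⟩
    exact (Polynomial.natDegree_pow_le_of_le k Polynomial.natDegree_quadratic_le).trans_eq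
      (mul_comm k 2)
  obtain ⟨p, hp, hpe⟩ := hq (-(r * ‖v‖ ^ 2)) (-(2 * r * inner ℝ x v)) (1 - r * ‖x‖ ^ 2)
  refine ⟨p, hp, fun t => ?_⟩
  rw [hpe, norm_add_sq_real, norm_smul, inner_smul_right, mul_pow, Real.norm_eq_abs, sq_abs]
  congr 1
  ring

/-! ### Zeros of compactly supported perturbations of the identity -/

section Degree

variable {E : Type*} [NormedAddCommGroup E] [InnerProductSpace ℝ E] [FiniteDimensional ℝ E]

/-- A small Lipschitz perturbation of the identity, supported in a ball, is a bijection of that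
ball. -/
theorem bijOn_closedBall_add_of_lipschitz {g : E → E} {K : NNReal} (hg : LipschitzWith K g)
    {R : ℝ} (hR : ∀ x, R < ‖x‖ → g x = 0) (hK : K < 1) :
    BijOn (fun x => x + g x) (Metric.closedBall 0 R) (Metric.closedBall 0 R) := by
  have hinj : Function.Injective (fun x => x + g x) := by
    intro x y hxy
    have h1 : x - y = g y - g x := by
      have : x + g x = y + g y := hxy
      rw [sub_eq_sub_iff_add_eq_add, this, add_comm]
    have h2 : ‖x - y‖ ≤ K * ‖x - y‖ := by
      conv_lhs => rw [h1]
      simpa [dist_eq_norm, norm_sub_rev] using hg.dist_le_mul y x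
    have hK' : (K : ℝ) < 1 := by exact_mod_cast hK
    have h3 : ‖x - y‖ = 0 := by nlinarith [norm_nonneg (x - y)]
    exact sub_eq_zero.1 (norm_eq_zero.1 h3)
  have hsurj : Function.Surjective (fun x => x + g x) := by
    intro y
    have hc : ContractingWith K (fun x => y - g x) :=
      ⟨hK, LipschitzWith.of_dist_le_mul fun a b => by
        simpa [dist_eq_norm, norm_sub_rev] using hg.dist_le_mul a b⟩
    refine ⟨hc.fixedPoint, ?_⟩
    have h : y - g hc.fixedPoint = hc.fixedPoint := hc.fixedPoint_isFixedPt
    calc hc.fixedPoint + g hc.fixedPoint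
        = (y - g hc.fixedPoint) + g hc.fixedPoint := by rw [h]
      _ = y := sub_add_cancel _ _
  refine ⟨fun x hx => ?_, hinj.injOn, fun y hy => ?_⟩
  · by_contra hy
    have h1 : R < ‖x + g x‖ := by simpa using hy
    have h2 : (fun x => x + g x) (x + g x) = (fun x => x + g x) x := by
      simp only [hR _ h1, add_zero]
    rw [hinj h2] at h1
    exact absurd (by simpa using hx) (not_le.2 h1)
  · obtain ⟨x, rfl⟩ := hsurj y
    refine ⟨x, ?_, rfl⟩
    by_contra hx
    have h1 : R < ‖x‖ := by simpa using hx
    simp only [hR _ h1, add_zero] at hy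
    exact hx hy

/-- Polynomial dependence on t carries the change of variables from small t, where the map is a
bijection, to t = 1, where it need not be injective. -/
theorem exists_polynomial_det_one_add_smul (A : E →L[ℝ] E) :
    ∃ p : Polynomial ℝ, p.natDegree ≤ Module.finrank ℝ E ∧
      ∀ t : ℝ, p.eval t = (ContinuousLinearMap.id ℝ E + t • A).det := by
  classical
  let b := Module.finBasis ℝ E
  let MA := LinearMap.toMatrix b b (A : E →ₗ[ℝ] E)
  refine ⟨((Polynomial.X : Polynomial ℝ) • MA.map Polynomial.C
    + (1 : Matrix _ _ ℝ).map Polynomial.C).det, ?_, fun t => ?_⟩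
  · simpa using Polynomial.natDegree_det_X_add_C_le MA 1
  · have h1 : (ContinuousLinearMap.id ℝ E + t • A).det = (1 + t • MA).det := by
      rw [ContinuousLinearMap.det, ← LinearMap.det_toMatrix b]
      congr 1
      simp [MA]
    rw [h1, ← Polynomial.coe_evalRingHom, RingHom.map_det]
    congr 1
    ext i j
    by_cases hij : i = j
    · subst hij; simp; ring
    · simp [hij]; ring

variable [MeasurableSpace E] [BorelSpace E]

/-- A compactly supported `C^1` perturbation of the identity has degree one, tested against
functions which are polynomial along lines. -/
theorem setIntegral_comp_mul_det_eq {g : E → E} (hg : ContDiff ℝ 1 g)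
    {R : ℝ} (hR : ∀ x, R < ‖x‖ → g x = 0) {φ : E → ℝ} (hφ : Continuous φ) {d : ℕ}
    (hpoly : ∀ x v, ∃ p : Polynomial ℝ, p.natDegree ≤ d ∧ ∀ t : ℝ, p.eval t = φ (x + t • v)) :
    ∫ x in Metric.closedBall (0 : E) R,
        (ContinuousLinearMap.id ℝ E + fderiv ℝ g x).det * φ (x + g x)
      = ∫ x in Metric.closedBall (0 : E) R, φ x := by
  have hcs : HasCompactSupport g := HasCompactSupport.intro (isCompact_closedBall (0 : E) R)
    fun x hx => hR x (by simpa using hx)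
  obtain ⟨C, hC⟩ := hg.lipschitzWith_of_hasCompactSupport hcs one_ne_zero
  have hdetc : Continuous (fun B : E →L[ℝ] E => B.det) := ContinuousLinearMap.continuous_det
  obtain ⟨δ, hδ, hdet⟩ : ∃ δ > 0, ∀ B : E →L[ℝ] E,
      dist B (ContinuousLinearMap.id ℝ E) < δ → 0 < B.det := by
    refine Metric.eventually_nhds_iff.1
      (hdetc.continuousAt.eventually (lt_mem_nhds (b := ContinuousLinearMap.det _) ?_))
    simp [ContinuousLinearMap.det]
  set J : ℝ → E → ℝ := fun t x =>
    (ContinuousLinearMap.id ℝ E + t • fderiv ℝ g x).det * φ (x + t • g x) with hJ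
  have hJc : ∀ t, Continuous (J t) := fun t => by
    have := hg.continuous_fderiv one_ne_zero
    have hgc := hg.continuous
    refine Continuous.mul (hdetc.comp (by fun_prop)) (by fun_prop)
  have hJi : ∀ t, IntegrableOn (J t) (Metric.closedBall 0 R) := fun t =>
    (hJc t).continuousOn.integrableOn_compact (isCompact_closedBall _ _)
  -- The first bound makes t • g a contraction; the second keeps the Jacobian positive, so the
  -- absolute value in the change of variables disappears.
  set τ : ℝ := min (1 / (2 * (C + 1))) (δ / (2 * (C + 1))) with hτ
  have hC1 : (0 : ℝ) < C + 1 := by positivity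
  have hτ0 : 0 < τ := by positivity
  have hsmall : ∀ t, 0 ≤ t → t ≤ τ →
      ∫ x in Metric.closedBall (0 : E) R, J t x = ∫ x in Metric.closedBall (0 : E) R, φ x := by
    intro t ht0 ht
    have ht1 : t * (C + 1) ≤ 1 / 2 := by
      calc t * (C + 1) ≤ 1 / (2 * (C + 1)) * (C + 1) := by gcongr; exact ht.trans (min_le_left _ _)
        _ = 1 / 2 := by field_simp
    have ht2 : t * (C + 1) ≤ δ / 2 := by
      calc t * (C + 1) ≤ δ / (2 * (C + 1)) * (C + 1) := by gcongr; exact ht.trans (min_le_right _ _)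
        _ = δ / 2 := by field_simp
    have hlip : LipschitzWith (t.toNNReal * C) (fun x => t • g x) :=
      LipschitzWith.of_dist_le_mul fun a b => by
        have := hC.dist_le_mul a b
        rw [dist_smul₀, Real.norm_of_nonneg ht0]
        rw [NNReal.coe_mul, Real.coe_toNNReal t ht0, mul_assoc]
        exact mul_le_mul_of_nonneg_left this ht0
    have hbij := bijOn_closedBall_add_of_lipschitz hlip (R := R)
      (fun x hx => by simp [hR x hx]) (by
        rw [← NNReal.coe_lt_coe, NNReal.coe_mul, Real.coe_toNNReal t ht0, NNReal.coe_one]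
        nlinarith)
    have hcv := integral_image_eq_integral_abs_det_fderiv_smul volume
      (s := Metric.closedBall (0 : E) R) (f := fun x => x + t • g x)
      (f' := fun x => ContinuousLinearMap.id ℝ E + t • fderiv ℝ g x)
      Metric.isClosed_closedBall.measurableSet
      (fun x _ => ((hasFDerivAt_id x).add
        (((hg.differentiable one_ne_zero) x).hasFDerivAt.const_smul t)).hasFDerivWithinAt)
      hbij.injOn φ
    rw [hbij.image_eq] at hcv
    rw [hcv]
    refine integral_congr_ae (Eventually.of_forall fun x => ?_)
    have hn : ‖fderiv ℝ g x‖ ≤ C := norm_fderiv_le_of_lipschitz ℝ hC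
    have : 0 < (ContinuousLinearMap.id ℝ E + t • fderiv ℝ g x).det := by
      apply hdet
      rw [dist_eq_norm, add_sub_cancel_left, norm_smul, Real.norm_of_nonneg ht0]
      nlinarith
    simp only [hJ, smul_eq_mul, abs_of_pos this]
  -- For each x the integrand J t x is a polynomial in t of degree at most D. Its value at t = 1 is
  -- interpolated from D + 1 nodes in [0, τ], with weights independent of x that sum to one.
  set D := Module.finrank ℝ E + d with hD
  set s : Finset ℕ := Finset.range (D + 1)
  set v : ℕ → ℝ := fun i => τ * (i / (D + 1)) with hv
  have hvinj : InjOn v s := by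
    intro i _ j _ hij
    have h1 : (i : ℝ) / (D + 1) = j / (D + 1) := mul_left_cancel₀ hτ0.ne' hij
    have h2 : (0 : ℝ) < D + 1 := by positivity
    have h3 : (i : ℝ) = j := by field_simp at h1; exact h1
    exact_mod_cast h3
  set L : ℕ → ℝ := fun i => (Lagrange.basis s v i).eval 1 with hL
  have hpt : ∀ x, J 1 x = ∑ i ∈ s, J (v i) x * L i := by
    intro x
    obtain ⟨p, hp, hpe⟩ := exists_polynomial_det_one_add_smul (fderiv ℝ g x)
    obtain ⟨q, hq, hqe⟩ := hpoly x (g x)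
    have hev : ∀ t, (p * q).eval t = J t x := fun t => by
      rw [Polynomial.eval_mul, hpe, hqe]
    have hdeg : (p * q).degree < s.card := by
      refine Polynomial.degree_le_natDegree.trans_lt ?_
      have : (p * q).natDegree ≤ D := Polynomial.natDegree_mul_le.trans (add_le_add hp hq)
      simp only [s, Finset.card_range]
      exact_mod_cast Nat.lt_succ_of_le this
    have := Lagrange.eq_interpolate_of_eval_eq (fun i => J (v i) x) hvinj hdeg
      (fun i _ => hev (v i))
    rw [← hev 1, this, Lagrange.interpolate_apply, Polynomial.eval_finsetSum]
    simp [hL]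
  have hsum : ∑ i ∈ s, L i = 1 := by
    have := Lagrange.sum_basis hvinj (by simp [s])
    have h2 := congrArg (Polynomial.eval 1) this
    rwa [Polynomial.eval_finsetSum, Polynomial.eval_one] at h2
  have h1 : ∫ x in Metric.closedBall (0 : E) R, J 1 x
      = ∫ x in Metric.closedBall (0 : E) R, φ x := by
    simp_rw [hpt]
    rw [integral_finsetSum _ fun i _ => (hJi (v i)).mul_const _]
    simp_rw [integral_mul_const]
    rw [← one_mul (∫ x in Metric.closedBall (0 : E) R, φ x), ← hsum, Finset.sum_mul]
    refine Finset.sum_congr rfl fun i hi => ?_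
    rw [hsmall (v i) (by positivity) ?_, mul_comm]
    have hi' : (i : ℝ) ≤ D + 1 := by
      have := Finset.mem_range.1 hi
      exact_mod_cast this.le
    have : (i : ℝ) / (D + 1) ≤ 1 := (div_le_one (by positivity)).2 hi'
    simp only [hv]; nlinarith
  simpa [hJ] using h1

/-- The degree identity is tested against powers of 1 - ‖y‖²/R², which concentrate at the origin. If
x + g x stayed at distance m > 0 from 0, one side would decay faster than the other as the power
grows. -/
theorem exists_add_eq_zero_of_contDiff {g : E → E} (hg : ContDiff ℝ 1 g)
    (hcs : HasCompactSupport g) : ∃ x, x + g x = 0 := by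
  by_contra! hne
  have hgc := hg.continuous
  obtain ⟨G, hG⟩ := hgc.bounded_above_of_compact_support hcs
  obtain ⟨R₀, hR₀⟩ := hcs.isCompact.isBounded.subset_closedBall 0
  have hz : ∀ x, R₀ < ‖x‖ → g x = 0 := fun x hx => by
    by_contra h
    have := hR₀ (subset_tsupport g h)
    exact absurd (by simpa using this) (not_le.2 hx)
  -- Large enough that the ball of radius R is mapped into itself: points beyond R₀ are fixed and
  -- the others move by at most G.
  set R := |R₀| + |G| + 1 with hRdef
  have hRpos : 0 < R := by positivity
  have hR : ∀ x, R < ‖x‖ → g x = 0 := fun x hx => hz x (by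
    have := le_abs_self R₀; have := abs_nonneg G; linarith)
  have hmap : ∀ x, ‖x‖ ≤ R → ‖x + g x‖ ≤ R := fun x hx => by
    by_cases h : R₀ < ‖x‖
    · simpa [hz x h] using hx
    · have := norm_add_le x (g x)
      have := hG x
      have := le_abs_self G; have := le_abs_self R₀
      linarith
  obtain ⟨x₁, hx₁, hmin⟩ := (isCompact_closedBall (0 : E) R).exists_isMinOn
    ⟨0, by simpa using hRpos.le⟩ (f := fun x => ‖x + g x‖) (by fun_prop)
  set m := ‖x₁ + g x₁‖ with hm
  have hm0 : 0 < m := norm_pos_iff.2 (hne x₁)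
  have hmR : m ≤ R := hmap x₁ (by simpa using hx₁)
  have hmle : ∀ x, ‖x‖ ≤ R → m ≤ ‖x + g x‖ := fun x hx => hmin (by simpa using hx)
  have hdetc : Continuous fun x => (ContinuousLinearMap.id ℝ E + fderiv ℝ g x).det :=
    ContinuousLinearMap.continuous_det.comp
      (continuous_const.add (hg.continuous_fderiv one_ne_zero))
  obtain ⟨C, hC⟩ := (isCompact_closedBall (0 : E) R).exists_bound_of_continuousOn
    hdetc.continuousOn
  set r := 1 / R ^ 2 with hr
  have hr0 : 0 < r := by positivity
  have hrR : r * R ^ 2 = 1 := by rw [hr]; field_simp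
  set a := 1 - r * (m / 2) ^ 2 with ha
  set b := 1 - r * m ^ 2 with hb
  have hb0 : 0 ≤ b := by
    have : r * m ^ 2 ≤ r * R ^ 2 := by gcongr
    linarith
  have hab : b < a := by
    have : 0 < r * m ^ 2 := by positivity
    rw [ha, hb]; nlinarith
  have ha0 : 0 < a := hb0.trans_lt hab
  set B := Metric.closedBall (0 : E) R
  set V₁ := volume.real (Metric.closedBall (0 : E) (m / 2))
  set V := volume.real B
  have hV₁ : 0 < V₁ := ENNReal.toReal_pos
    (Metric.measure_closedBall_pos volume _ (by positivity)).ne'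
    (measure_closedBall_lt_top).ne
  have key : ∀ k : ℕ, V₁ * a ^ k ≤ (C * V) * b ^ k := by
    intro k
    set φ : E → ℝ := fun y => (1 - r * ‖y‖ ^ 2) ^ k with hφ
    have hφc : Continuous φ := by fun_prop
    have hid := setIntegral_comp_mul_det_eq hg hR hφc
      (fun x v => exists_polynomial_one_sub_norm_sq_pow r k x v)
    have hnn : ∀ x ∈ B, 0 ≤ 1 - r * ‖x‖ ^ 2 := fun x hx => by
      have hx' : ‖x‖ ≤ R := by simpa [B] using hx
      have : r * ‖x‖ ^ 2 ≤ r * R ^ 2 := by gcongr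
      linarith
    have hsub : Metric.closedBall (0 : E) (m / 2) ⊆ B :=
      Metric.closedBall_subset_closedBall (by linarith)
    have h1 : V₁ * a ^ k ≤ ∫ x in B, φ x := by
      calc V₁ * a ^ k = ∫ _ in Metric.closedBall (0 : E) (m / 2), a ^ k := by
            rw [setIntegral_const, smul_eq_mul]
        _ ≤ ∫ x in Metric.closedBall (0 : E) (m / 2), φ x := by
            refine setIntegral_mono_on
              (continuous_const.continuousOn.integrableOn_compact (isCompact_closedBall _ _))
              (hφc.continuousOn.integrableOn_compact (isCompact_closedBall _ _))
              Metric.isClosed_closedBall.measurableSet fun x hx => ?_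
            have hx' : ‖x‖ ≤ m / 2 := by simpa using hx
            have : r * ‖x‖ ^ 2 ≤ r * (m / 2) ^ 2 := by gcongr
            exact pow_le_pow_left₀ ha0.le (by rw [ha]; linarith) k
        _ ≤ ∫ x in B, φ x := by
            refine setIntegral_mono_set
              (hφc.continuousOn.integrableOn_compact (isCompact_closedBall _ _)) ?_
              hsub.eventuallyLE
            exact (ae_restrict_iff' Metric.isClosed_closedBall.measurableSet).2
              (Eventually.of_forall fun x hx => pow_nonneg (hnn x hx) k)
    have h2 : ‖∫ x in B, (ContinuousLinearMap.id ℝ E + fderiv ℝ g x).det * φ (x + g x)‖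
        ≤ (C * b ^ k) * V := by
      refine norm_setIntegral_le_of_norm_le_const measure_closedBall_lt_top fun x hx => ?_
      have hx' : ‖x‖ ≤ R := by simpa [B] using hx
      have hC' := hC x hx
      rw [norm_mul]
      refine mul_le_mul hC' ?_ (norm_nonneg _) ((norm_nonneg _).trans hC')
      have hF := hmap x hx'
      have h0 := hnn (x + g x) (by simpa [B] using hF)
      rw [hφ, Real.norm_of_nonneg (pow_nonneg h0 k)]
      refine pow_le_pow_left₀ h0 ?_ k
      have := hmle x hx'
      have : r * m ^ 2 ≤ r * ‖x + g x‖ ^ 2 := by gcongr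
      rw [hb]; linarith
    rw [hid] at h2
    calc V₁ * a ^ k ≤ _ := h1
      _ ≤ _ := Real.le_norm_self _
      _ ≤ _ := h2
      _ = _ := by ring
  have hlim : Tendsto (fun k : ℕ => (C * V) * (b / a) ^ k) atTop (𝓝 ((C * V) * 0)) :=
    (tendsto_pow_atTop_nhds_zero_of_lt_one (by positivity) ((div_lt_one ha0).2 hab)).const_mul _
  have hle : V₁ ≤ (C * V) * 0 := ge_of_tendsto' hlim fun k => by
    have := key k
    rw [div_pow, ← mul_div_assoc, le_div_iff₀ (by positivity)]
    exact this
  linarith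

/-- A continuous compactly supported perturbation of the identity has a zero. -/
theorem exists_add_eq_zero_of_continuous {g : E → E} (hg : Continuous g)
    (hcs : HasCompactSupport g) : ∃ x, x + g x = 0 := by
  by_contra! hne
  -- With this pointwise tolerance, a zero of x + h x would have distance from h x to g x exactly
  -- equal to ‖x + g x‖, against the strict inequality.
  obtain ⟨h, hh, hdist, hsupp⟩ := hg.exists_contDiff_approx 1
    (ε := fun x => ‖x + g x‖) (by fun_prop) (fun x => norm_pos_iff.2 (hne x))
  have hcs' : HasCompactSupport h := hcs.mono hsupp
  obtain ⟨x, hx⟩ := exists_add_eq_zero_of_contDiff hh hcs'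
  have h1 := hdist x
  rw [dist_eq_norm, eq_neg_of_add_eq_zero_right hx] at h1
  rw [← neg_add', norm_neg] at h1
  exact lt_irrefl _ h1

end Degree

/-! ### Invariance of domain in Euclidean space -/

section InvarianceOfDomain

variable {E : Type*} [NormedAddCommGroup E] [InnerProductSpace ℝ E] [FiniteDimensional ℝ E]
  [MeasurableSpace E] [BorelSpace E]

/-- A continuous map of the closed unit ball that stays close to the identity has a zero. -/
theorem exists_eq_zero_of_norm_sub_le {q : E → E}
    (hq : ContinuousOn q (Metric.closedBall 0 1))
    (hclose : ∀ x ∈ Metric.closedBall (0 : E) 1, ‖q x - x‖ ≤ 1 / 2) :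
    ∃ x ∈ Metric.closedBall (0 : E) 1, q x = 0 := by
  set pr : E → E := fun x => (max 1 ‖x‖)⁻¹ • x with hpr
  have hmax : ∀ x : E, max 1 ‖x‖ ≠ 0 := fun x => (lt_max_of_lt_left one_pos).ne'
  have hprc : Continuous pr := by
    refine Continuous.smul (Continuous.inv₀ (by fun_prop) hmax) continuous_id
  have hprm : ∀ x, pr x ∈ Metric.closedBall (0 : E) 1 := fun x => by
    have h0 : 0 < max 1 ‖x‖ := lt_max_of_lt_left one_pos
    rw [mem_closedBall_zero_iff, hpr, norm_smul, norm_inv, Real.norm_of_nonneg h0.le,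
      inv_mul_le_one₀ h0]
    exact le_max_right _ _
  have hprid : ∀ x ∈ Metric.closedBall (0 : E) 1, pr x = x := fun x hx => by
    simp [hpr, max_eq_left (mem_closedBall_zero_iff.1 hx)]
  set χ : E → ℝ := fun x => max 0 (min 1 (2 - 2 * ‖x‖)) with hχ
  have hχ0 : ∀ x, 0 ≤ χ x := fun x => le_max_left _ _
  have hχ1 : ∀ x, χ x ≤ 1 := fun x => max_le zero_le_one (min_le_left _ _)
  set g : E → E := fun x => χ x • (q (pr x) - pr x) with hg
  have hgc : Continuous g := by
    have h1 : Continuous fun x => q (pr x) := hq.comp_continuous hprc hprm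
    have h2 : Continuous χ := by fun_prop
    exact h2.smul (h1.sub hprc)
  have hcs : HasCompactSupport g := HasCompactSupport.intro (isCompact_closedBall (0 : E) 1)
    fun x hx => by
      have hx' : 1 < ‖x‖ := by simpa using hx
      have : χ x = 0 := max_eq_left ((min_le_right _ _).trans (by linarith))
      simp [hg, this]
  obtain ⟨x, hx⟩ := exists_add_eq_zero_of_continuous hgc hcs
  have hgn : ‖g x‖ ≤ 1 / 2 := by
    rw [hg, norm_smul, Real.norm_of_nonneg (hχ0 x)]
    have := hclose _ (hprm x)
    have := hχ1 x
    nlinarith [hχ0 x, norm_nonneg (q (pr x) - pr x)]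
  have hxn : ‖x‖ ≤ 1 / 2 := by
    rwa [eq_neg_of_add_eq_zero_left hx, norm_neg]
  have hxm : x ∈ Metric.closedBall (0 : E) 1 := by
    rw [mem_closedBall_zero_iff]; linarith
  refine ⟨x, hxm, ?_⟩
  have hχx : χ x = 1 := by
    rw [hχ]; simp only
    rw [min_eq_left (by linarith), max_eq_right zero_le_one]
  simpa [hg, hχx, hprid x hxm] using hx

/-- Invariance of domain for the unit ball. -/
theorem image_closedBall_mem_nhds_of_injOn {f : E → E}
    (hf : ContinuousOn f (Metric.closedBall 0 1)) (hinj : InjOn f (Metric.closedBall 0 1)) :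
    f '' Metric.closedBall 0 1 ∈ 𝓝 (f 0) := by
  by_contra hnot
  set B := Metric.closedBall (0 : E) 1 with hB
  have h0B : (0 : E) ∈ B := by simp [hB]
  have hBc : IsCompact B := isCompact_closedBall _ _
  have hfB : IsCompact (f '' B) := hBc.image_of_continuousOn hf
  -- a continuous extension of the inverse
  obtain ⟨H, hHc, hH⟩ : ∃ H : E → E, Continuous H ∧ ∀ x ∈ B, H (f x) = x := by
    have : CompactSpace B := isCompact_iff_compactSpace.1 hBc
    have hemb : IsClosedEmbedding (fun x : B => f x) :=
      Continuous.isClosedEmbedding (continuousOn_iff_continuous_domRestrict.1 hf)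
        (fun x y hxy => Subtype.ext (hinj x.2 y.2 hxy))
    have : TietzeExtension E := TietzeExtension.of_tvs ℝ
    obtain ⟨H, hH⟩ := ContinuousMap.exists_extension hemb
      (⟨fun x : B => (x : E), continuous_subtype_val⟩ : C(B, E))
    exact ⟨H, H.continuous, fun x hx => DFunLike.congr_fun hH ⟨x, hx⟩⟩
  have hH0 : H (f 0) = 0 := hH 0 h0B
  obtain ⟨ε, hε, hHε⟩ : ∃ ε > 0, ∀ y, dist y (f 0) < 2 * ε → ‖H y‖ ≤ 1 / 10 := by
    obtain ⟨ε, hε, h⟩ := Metric.continuousAt_iff.1 (hHc.continuousAt (x := f 0)) (1 / 10)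
      (by norm_num)
    refine ⟨ε / 2, by positivity, fun y hy => ?_⟩
    have := h (show dist y (f 0) < ε by linarith)
    rw [hH0, dist_zero_right] at this
    exact this.le
  obtain ⟨c, hcε, hc⟩ : ∃ c, dist c (f 0) < ε ∧ c ∉ f '' B := by
    by_contra! hcon
    exact hnot (Metric.mem_nhds_iff.2 ⟨ε, hε, fun c hc => hcon c hc⟩)
  -- The point f 0, the only zero of H on the image, is within ε of c and hence not in S. The plan
  -- is to push the image off the ball around the omitted point c, into S and the sphere, and to
  -- perturb H so that it has no zero on either.
  set S := f '' B ∩ {y | ε ≤ dist y c} with hS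
  have hSc : IsCompact S := hfB.inter_right (isClosed_le continuous_const (by fun_prop))
  have hSne : ∀ y ∈ S, H y ≠ 0 := by
    rintro y ⟨⟨x, hx, rfl⟩, hy⟩ h
    rw [hH x hx] at h
    rw [h, mem_ofPred_eq, dist_comm] at hy
    exact absurd hcε (not_lt.2 hy)
  obtain ⟨δ, hδ0, hδ1, hδ⟩ : ∃ δ : ℝ, 0 < δ ∧ δ ≤ 1 / 10 ∧ ∀ y ∈ S, δ ≤ ‖H y‖ := by
    rcases S.eq_empty_or_nonempty with h | h
    · exact ⟨1 / 10, by norm_num, le_rfl, by simp [h]⟩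
    · obtain ⟨y, hy, hmin⟩ := hSc.exists_isMinOn h (f := fun y => ‖H y‖) (by fun_prop)
      exact ⟨min (1 / 10) ‖H y‖, lt_min (by norm_num) (norm_pos_iff.2 (hSne y hy)),
        min_le_left _ _, fun z hz => (min_le_right _ _).trans (hmin hz)⟩
  obtain ⟨P, hP, hPH, -⟩ := hHc.exists_contDiff_approx 1 (ε := fun _ => δ / 2)
    continuous_const (fun _ => by positivity)
  have hPd : Differentiable ℝ P := hP.differentiable (by norm_num)
  -- A differentiable map sends the null set `Metric.sphere c ε` to a null set, so arbitrarily small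
  -- values are omitted.
  obtain ⟨e, he, heS⟩ : ∃ e : E, ‖e‖ < δ / 2 ∧ ∀ y ∈ Metric.sphere c ε, P y ≠ e := by
    have hnull : volume (P '' Metric.sphere c ε) = 0 :=
      addHaar_image_eq_zero_of_differentiableOn_of_addHaar_eq_zero volume hPd.differentiableOn
        (Measure.addHaar_sphere_of_ne_zero volume c hε.ne')
    have hdense : Dense {e | e ∉ P '' Metric.sphere c ε} :=
      Measure.dense_of_ae (μ := volume) (measure_eq_zero_iff_ae_notMem.1 hnull)
    obtain ⟨e, he, he'⟩ := hdense.exists_dist_lt 0 (half_pos hδ0)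
    exact ⟨e, by simpa using he', fun y hy h => he ⟨y, hy, h⟩⟩
  set P' : E → E := fun y => P y - e with hP'
  have hP'H : ∀ y, ‖P' y - H y‖ < δ := fun y => by
    have h1 := hPH y
    rw [dist_eq_norm] at h1
    calc ‖P' y - H y‖ = ‖(P y - H y) - e‖ := by rw [hP', sub_right_comm]
      _ ≤ ‖P y - H y‖ + ‖e‖ := norm_sub_le _ _
      _ < δ := by linarith
  set ρ : E → E := fun y => c + (max 1 (ε / ‖y - c‖)) • (y - c) with hρ
  have hne : ∀ y ∈ f '' B, ‖y - c‖ ≠ 0 := fun y hy h => by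
    rw [norm_eq_zero, sub_eq_zero] at h
    exact hc (h ▸ hy)
  have hρc : ContinuousOn ρ (f '' B) := by
    refine continuousOn_const.add (ContinuousOn.smul ?_ (by fun_prop))
    exact ContinuousOn.sup continuousOn_const (continuousOn_const.div (by fun_prop) hne)
  have hρ1 : ∀ y ∈ f '' B, ε ≤ dist y c → ρ y = y := fun y hy h => by
    rw [dist_eq_norm] at h
    have h0 : 0 < ‖y - c‖ := (norm_nonneg _).lt_of_ne' (hne y hy)
    have : max 1 (ε / ‖y - c‖) = 1 := max_eq_left ((div_le_one h0).2 h)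
    simp [hρ, this]
  have hρ2 : ∀ y ∈ f '' B, dist y c < ε → ρ y ∈ Metric.sphere c ε := fun y hy h => by
    rw [dist_eq_norm] at h
    have h0 : 0 < ‖y - c‖ := (norm_nonneg _).lt_of_ne' (hne y hy)
    have : max 1 (ε / ‖y - c‖) = ε / ‖y - c‖ := max_eq_right ((one_le_div h0).2 h.le)
    rw [mem_sphere_iff_norm, hρ]
    simp only [this, add_sub_cancel_left, norm_smul, norm_div, norm_norm]
    rw [Real.norm_of_nonneg hε.le, div_mul_cancel₀ _ h0.ne']
  -- This map is close to H ∘ f, the identity: where ρ moves f x, both H (ρ (f x)) and x have norm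
  -- at most 1/10.
  obtain ⟨x, hx, hzero⟩ := exists_eq_zero_of_norm_sub_le (q := fun x => P' (ρ (f x)))
    ((hPd.continuous.sub continuous_const).comp_continuousOn
      (hρc.comp hf (mapsTo_image f B))) (fun x hx => by
        have hfx := mem_image_of_mem f hx
        by_cases h : ε ≤ dist (f x) c
        · rw [hρ1 _ hfx h]
          have := hP'H (f x)
          rw [hH x hx] at this
          linarith
        · push Not at h
          have hs := hρ2 _ hfx h
          have h1 : ‖H (ρ (f x))‖ ≤ 1 / 10 := hHε _ (by
            have := dist_triangle (ρ (f x)) c (f 0)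
            rw [Metric.mem_sphere.1 hs] at this
            linarith)
          have h2 : ‖x‖ ≤ 1 / 10 := by
            have := hHε (f x) (by have := dist_triangle (f x) c (f 0); linarith)
            rwa [hH x hx] at this
          have h3 := hP'H (ρ (f x))
          calc ‖P' (ρ (f x)) - x‖
              = ‖(P' (ρ (f x)) - H (ρ (f x))) + (H (ρ (f x)) - x)‖ := by congr 1; abel
            _ ≤ ‖P' (ρ (f x)) - H (ρ (f x))‖ + ‖H (ρ (f x)) - x‖ := norm_add_le _ _
            _ ≤ δ + (‖H (ρ (f x))‖ + ‖x‖) := add_le_add h3.le (norm_sub_le _ _)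
            _ ≤ 1 / 2 := by linarith)
  have hfx := mem_image_of_mem f hx
  by_cases h : ε ≤ dist (f x) c
  · simp only [hρ1 _ hfx h] at hzero
    have h1 := hδ (f x) ⟨hfx, h⟩
    have h2 := hP'H (f x)
    rw [hzero, zero_sub, norm_neg] at h2
    linarith
  · push Not at h
    exact heS _ (hρ2 _ hfx h) (sub_eq_zero.1 hzero)

end InvarianceOfDomain

/-! ### Invariance of domain on manifolds -/

section Charted

variable {n : ℕ} {N : Type*} [TopologicalSpace N]
  [ChartedSpace (EuclideanSpace ℝ (Fin n)) N]

/-- Invariance of domain: an injective continuous map from an open subset of an `n`-dimensional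
manifold to an `n`-dimensional vector space is open. -/
theorem image_mem_nhds_of_injOn {F : Type*} [NormedAddCommGroup F] [NormedSpace ℝ F]
    [FiniteDimensional ℝ F] (hF : Module.finrank ℝ F = n) {G : N → F} {U : Set N}
    (hU : IsOpen U) (hG : ContinuousOn G U) (hinj : InjOn G U) {y : N} (hy : y ∈ U) {V : Set N}
    (hV : V ∈ 𝓝 y) : G '' V ∈ 𝓝 (G y) := by
  let E := EuclideanSpace ℝ (Fin n)
  let L : F ≃L[ℝ] E := ContinuousLinearEquiv.ofFinrankEq (by simp [E, hF])
  let ψ := chartAt E y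
  have hys : ψ y ∈ ψ.target := mem_chart_target E y
  have hpre : ψ.symm ⁻¹' (V ∩ U) ∩ ψ.target ∈ 𝓝 (ψ y) := by
    refine inter_mem ((ψ.continuousAt_symm hys).preimage_mem_nhds ?_) (ψ.open_target.mem_nhds hys)
    rw [ψ.left_inv (mem_chart_source E y)]
    exact inter_mem hV (hU.mem_nhds hy)
  obtain ⟨r, hr, hball⟩ := Metric.nhds_basis_closedBall.mem_iff.1 hpre
  let s : E → E := fun x => ψ y + r • x
  have hs : MapsTo s (Metric.closedBall 0 1) (Metric.closedBall (ψ y) r) := fun x hx => by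
    have hx' : ‖x‖ ≤ 1 := by simpa using hx
    rw [mem_closedBall_iff_norm, add_sub_cancel_left, norm_smul, Real.norm_of_nonneg hr.le]
    nlinarith
  have hsc : Continuous s := by fun_prop
  have hmaps : MapsTo (fun x => ψ.symm (s x)) (Metric.closedBall 0 1) (V ∩ U) :=
    fun x hx => (hball (hs hx)).1
  have key := image_closedBall_mem_nhds_of_injOn (f := fun x => L (G (ψ.symm (s x)))) (by
      refine L.continuous.comp_continuousOn (hG.comp ?_ fun x hx => (hmaps hx).2)
      exact ψ.continuousOn_symm.comp hsc.continuousOn fun x hx => (hball (hs hx)).2) (by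
      intro a ha b hb hab
      have h1 := hinj (hmaps ha).2 (hmaps hb).2 (L.injective hab)
      have h2 := ψ.symm.injOn (hball (hs ha)).2 (hball (hs hb)).2 h1
      exact smul_right_injective E hr.ne' (add_left_cancel h2))
  have h0 : ψ.symm (s 0) = y := by
    simp [s, ψ.left_inv (mem_chart_source E y)]
  simp only [h0] at key
  have h2 := L.continuous.continuousAt.preimage_mem_nhds key
  refine mem_of_superset h2 ?_
  rintro p ⟨x, hx, hxp⟩
  exact ⟨_, (hmaps hx).1, L.injective hxp⟩

end Charted

/-! ### First-order calculus of the cost in charts -/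

section LocalExpansion

variable {n : ℕ} {M N : Type*}
  [TopologicalSpace M] [ChartedSpace (EuclideanSpace ℝ (Fin n)) M]
  [TopologicalSpace N] [ChartedSpace (EuclideanSpace ℝ (Fin n)) N]

/-- `diff` is the derivative in the preferred chart. -/
theorem hasFDerivAt_comp_extChartAt_symm {u : M → ℝ} {x : M}
    (hu : MDifferentiableAt (𝓡 n) 𝓘(ℝ, ℝ) u x) :
    HasFDerivAt (fun a => u ((extChartAt (𝓡 n) x).symm a)) (diff n u x)
      (extChartAt (𝓡 n) x x) := by
  have h := hu.hasMFDerivAt.2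
  simp only [writtenInExtChartAt, extChartAt_model_space_eq_id, ModelWithCorners.range_eq_univ] at h
  exact hasFDerivWithinAt_univ.1 h

theorem tendsto_extChartAt_symm (x : M) :
    Tendsto (extChartAt (𝓡 n) x).symm (𝓝 (extChartAt (𝓡 n) x x)) (𝓝 x) := by
  have := continuousAt_extChartAt_symm (I := 𝓡 n) x
  rwa [ContinuousAt, extChartAt_to_inv] at this

theorem CostC1.contMDiffAt {c : M → N → ℝ} {Ω : Set M} {Ω' : Set N} (hc : CostC1 n c Ω Ω')
    (hΩ : IsOpen Ω) (hΩ' : IsOpen Ω') {x : M} (hx : x ∈ Ω) {y : N} (hy : y ∈ Ω') :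
    ContMDiffAt ((𝓡 n).prod (𝓡 n)) 𝓘(ℝ, ℝ) 1 (Function.uncurry c) (x, y) :=
  ContMDiffOn.contMDiffAt hc ((hΩ.prod hΩ').mem_nhds ⟨hx, hy⟩)

theorem CostC1.continuousAt {c : M → N → ℝ} {Ω : Set M} {Ω' : Set N} (hc : CostC1 n c Ω Ω')
    (hΩ : IsOpen Ω) (hΩ' : IsOpen Ω') {x : M} (hx : x ∈ Ω) {y : N} (hy : y ∈ Ω') :
    ContinuousAt (Function.uncurry c) (x, y) :=
  (hc.contMDiffAt hΩ hΩ' hx hy).continuousAt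

theorem CostC1.mdifferentiableAt_fst {c : M → N → ℝ} {Ω : Set M} {Ω' : Set N}
    (hc : CostC1 n c Ω Ω') (hΩ : IsOpen Ω) (hΩ' : IsOpen Ω') {x : M} (hx : x ∈ Ω) {y : N}
    (hy : y ∈ Ω') : MDifferentiableAt (𝓡 n) 𝓘(ℝ, ℝ) (fun x' => c x' y) x := by
  have h1 : ContMDiffAt (𝓡 n) ((𝓡 n).prod (𝓡 n)) 1 (fun x' : M => (x', y)) x :=
    contMDiffAt_id.prodMk contMDiffAt_const
  exact ((hc.contMDiffAt hΩ hΩ' hx hy).comp x h1).mdifferentiableAt one_ne_zero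

theorem CostC1.mdifferentiableAt_snd {c : M → N → ℝ} {Ω : Set M} {Ω' : Set N}
    (hc : CostC1 n c Ω Ω') (hΩ : IsOpen Ω) (hΩ' : IsOpen Ω') {x : M} (hx : x ∈ Ω) {y : N}
    (hy : y ∈ Ω') : MDifferentiableAt (𝓡 n) 𝓘(ℝ, ℝ) (fun y' => c x y') y := by
  have h1 : ContMDiffAt (𝓡 n) ((𝓡 n).prod (𝓡 n)) 1 (fun y' : N => (x, y')) y :=
    contMDiffAt_const.prodMk contMDiffAt_id
  exact ((hc.contMDiffAt hΩ hΩ' hx hy).comp y h1).mdifferentiableAt one_ne_zero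

/-- First order expansion of a `C^1` cost in the first variable, uniform in both variables. -/
theorem CostC1.exists_nhds_expansion {c : M → N → ℝ} {Ω : Set M} {Ω' : Set N}
    (hc : CostC1 n c Ω Ω') (hΩ : IsOpen Ω) (hΩ' : IsOpen Ω') {x₀ : M} (hx : x₀ ∈ Ω) {y₁ : N}
    (hy : y₁ ∈ Ω') {ε : ℝ} (hε : 0 < ε) :
    ∃ s ∈ 𝓝 (extChartAt (𝓡 n) x₀ x₀), ∃ V ∈ 𝓝 y₁, ∀ a ∈ s, ∀ a' ∈ s, ∀ y ∈ V,
      ‖c ((extChartAt (𝓡 n) x₀).symm a) y - c ((extChartAt (𝓡 n) x₀).symm a') y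
        + negD n c x₀ y₁ (a - a')‖ ≤ ε * ‖a - a'‖ := by
  let E := EuclideanSpace ℝ (Fin n)
  set φ := extChartAt (𝓡 n) x₀ with hφ
  set ψ := extChartAt (𝓡 n) y₁ with hψ
  let C : E × E → ℝ := fun p => c (φ.symm p.1) (ψ.symm p.2)
  have hC : ContDiffAt ℝ 1 C (φ x₀, ψ y₁) := by
    have h := (contMDiffAt_iff.1 (hc.contMDiffAt hΩ hΩ' hx hy)).2
    have hr : range ((𝓡 n).prod (𝓡 n)) = univ := by
      rw [modelWithCorners_prod_coe, Set.range_prodMap]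
      simp
    rw [hr, contDiffWithinAt_univ, extChartAt_prod] at h
    simp only [extChartAt_model_space_eq_id] at h
    exact h
  -- Strict differentiability of the joint cost gives the uniformity; for two points with the same
  -- second coordinate only the first partial derivative contributes.
  have hs := hC.hasStrictFDerivAt one_ne_zero
  set L := fderiv ℝ C (φ x₀, ψ y₁) with hL
  have hLG : ∀ v, L (v, 0) = -negD n c x₀ y₁ v := by
    intro v
    have h1 : HasFDerivAt (fun a => C (a, ψ y₁)) (L.comp (ContinuousLinearMap.inl ℝ E E)) (φ x₀) := by
      have hin : HasFDerivAt (fun a : E => (a, ψ y₁)) (ContinuousLinearMap.inl ℝ E E) (φ x₀) :=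
        (hasFDerivAt_id (φ x₀)).prodMk (hasFDerivAt_const (ψ y₁) (φ x₀))
      exact hs.hasFDerivAt.comp (φ x₀) hin
    have h2 := hasFDerivAt_comp_extChartAt_symm (hc.mdifferentiableAt_fst hΩ hΩ' hx hy)
    have h3 : (fun a => C (a, ψ y₁)) = fun a => c (φ.symm a) y₁ := by
      funext a
      simp only [C, hψ, extChartAt_to_inv]
    rw [h3] at h1
    have h4 := h1.unique h2
    have h5 := congrArg (fun l : E →L[ℝ] ℝ => l v) h4
    simp only [ContinuousLinearMap.comp_apply, ContinuousLinearMap.inl_apply] at h5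
    rw [h5, negD]
    simp
  have hev := (hasStrictFDerivAt_iff_isLittleO.1 hs).def hε
  rw [nhds_prod_eq, nhds_prod_eq] at hev
  obtain ⟨t, ht, htC⟩ := mem_prod_same_iff.1 hev
  obtain ⟨s, hs', W, hW, hsW⟩ := mem_prod_iff.1 ht
  refine ⟨s, hs', ψ ⁻¹' W ∩ ψ.source, inter_mem
    ((continuousAt_extChartAt y₁).preimage_mem_nhds hW) (extChartAt_source_mem_nhds y₁), ?_⟩
  intro a ha a' ha' y hy'
  have h := htC (mk_mem_prod (hsW (mk_mem_prod ha hy'.1) : (a, ψ y) ∈ t)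
    (hsW (mk_mem_prod ha' hy'.1) : (a', ψ y) ∈ t))
  simp only [mem_ofPred_eq] at h
  have h6 : ((a, ψ y) : E × E) - (a', ψ y) = (a - a', 0) := by simp
  have h7 : ‖((a - a', 0) : E × E)‖ = ‖a - a'‖ := by simp [Prod.norm_def]
  rw [h6, hLG, h7] at h
  simpa only [C, ψ.left_inv hy'.2, sub_neg_eq_add] using h

theorem CostC1.continuousOn_negD {c : M → N → ℝ} {Ω : Set M} {Ω' : Set N}
    (hc : CostC1 n c Ω Ω') (hΩ : IsOpen Ω) (hΩ' : IsOpen Ω') {x₀ : M} (hx : x₀ ∈ Ω) :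
    ContinuousOn (fun y => negD n c x₀ y) Ω' := by
  intro y₁ hy
  refine ContinuousAt.continuousWithinAt (Metric.continuousAt_iff'.2 fun ε hε => ?_)
  obtain ⟨s, hs, V, hV, h⟩ := hc.exists_nhds_expansion hΩ hΩ' hx hy (half_pos hε)
  filter_upwards [hV, hΩ'.mem_nhds hy] with y hyV hyΩ
  have h1 := hasFDerivAt_comp_extChartAt_symm (hc.mdifferentiableAt_fst hΩ hΩ' hx hyΩ)
  have h2 := h1.add (negD n c x₀ y₁).hasFDerivAt
  -- The uniform expansion is a Lipschitz bound near x₀ for c(·, y) plus a linear map, and this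
  -- bounds its derivative.
  have h3 := h2.le_of_lip' (half_pos hε).le (by
    filter_upwards [hs] with a ha
    have := h a ha _ (mem_of_mem_nhds hs) y hyV
    rw [map_sub] at this
    refine le_of_eq_of_le (congrArg norm ?_) this
    exact add_sub_add_comm _ _ _ _)
  have h4 : negD n c x₀ y - negD n c x₀ y₁ =
      -(diff n (fun x' => c x' y) x₀ + negD n c x₀ y₁) := by
    simp only [negD]; abel
  rw [dist_eq_norm, h4, norm_neg]
  exact h3.trans_lt (half_lt_self hε)

/-- The derivative of `u + c(·, y)` vanishes at a local minimum. -/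
theorem diff_eq_negD_of_isLocalMin {n : ℕ} {M N : Type*} [TopologicalSpace M]
    [ChartedSpace (EuclideanSpace ℝ (Fin n)) M] {c : M → N → ℝ} {u : M → ℝ} {x : M} {y : N}
    (hu : MDifferentiableAt (𝓡 n) 𝓘(ℝ, ℝ) u x)
    (hc : MDifferentiableAt (𝓡 n) 𝓘(ℝ, ℝ) (fun x' => c x' y) x)
    (hmin : ∀ᶠ x' in 𝓝 x, u x + c x y ≤ u x' + c x' y) : diff n u x = negD n c x y := by
  have h1 := (hasFDerivAt_comp_extChartAt_symm hu).add (hasFDerivAt_comp_extChartAt_symm hc)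
  have h2 : IsLocalMin ((fun a => u ((extChartAt (𝓡 n) x).symm a)) +
      fun a => c ((extChartAt (𝓡 n) x).symm a) y) (extChartAt (𝓡 n) x x) := by
    filter_upwards [(tendsto_extChartAt_symm x).eventually hmin] with a ha
    simpa only [Pi.add_apply, extChartAt_to_inv] using ha
  rw [negD]
  exact eq_neg_of_add_eq_zero_left (h2.hasFDerivAt_eq_zero h1)

/-- A local extremum of `c(x₁, ·) - c(x₂, ·)` is excluded by the twist condition. -/
theorem Twist.eq_of_isLocalMin {c : M → N → ℝ} {Ω : Set M} {Ω' : Set N}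
    (htw : Twist n c Ω Ω') (hc : CostC1 n c Ω Ω') (hΩ : IsOpen Ω) (hΩ' : IsOpen Ω')
    {x₁ x₂ : M} (hx₁ : x₁ ∈ Ω) (hx₂ : x₂ ∈ Ω) {y : N} (hy : y ∈ Ω')
    (hmin : ∀ᶠ y' in 𝓝 y, c x₁ y - c x₂ y ≤ c x₁ y' - c x₂ y') : x₁ = x₂ := by
  refine htw.2 y hy hx₁ hx₂ ?_
  have h := diff_eq_negD_of_isLocalMin (c := fun y' x => -c x y') (u := fun y' => c x₁ y') (y := x₂)
    (hc.mdifferentiableAt_snd hΩ hΩ' hx₁ hy)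
    ((hc.mdifferentiableAt_snd hΩ hΩ' hx₂ hy).neg) (by simpa only [← sub_eq_add_neg] using hmin)
  have h2 := (hasFDerivAt_comp_extChartAt_symm (hc.mdifferentiableAt_snd hΩ hΩ' hx₂ hy)).neg
  have h3 := hasFDerivAt_comp_extChartAt_symm (hc.mdifferentiableAt_snd hΩ hΩ' hx₂ hy).neg
  have h4 : diff n (fun y' => -c x₂ y') y = -diff n (fun y' => c x₂ y') y := h3.unique h2
  simp only [negD, h4, neg_neg] at h
  simp only [negDbar, h]

/-- A function is differentiable in the chart at `x₀` at points near `x₀` where it is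
differentiable. -/
theorem differentiableAt_comp_extChartAt_symm [IsManifold (𝓡 n) ∞ M] {u : M → ℝ} {x₀ : M}
    {a : EuclideanSpace ℝ (Fin n)} (ha : a ∈ (extChartAt (𝓡 n) x₀).target)
    (hu : MDifferentiableAt (𝓡 n) 𝓘(ℝ, ℝ) u ((extChartAt (𝓡 n) x₀).symm a)) :
    DifferentiableAt ℝ (fun a => u ((extChartAt (𝓡 n) x₀).symm a)) a := by
  have h1 : ContMDiffAt 𝓘(ℝ, EuclideanSpace ℝ (Fin n)) (𝓡 n) ∞ (extChartAt (𝓡 n) x₀).symm a :=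
    (contMDiffOn_extChartAt_symm x₀).contMDiffAt
      ((isOpen_extChartAt_target x₀).mem_nhds ha)
  exact (hu.comp a (h1.mdifferentiableAt (by simp))).differentiableAt

end LocalExpansion

/-- The global `c`-subdifferential at `x` of a function `u` with domain `D`. -/
def cSubdiff {M N : Type*} (c : M → N → ℝ) (D : Set M) (u : M → ℝ) (x : M) : Set N :=
  {y | ∀ x' ∈ D, u x + c x y ≤ u x' + c x' y}

/-- A function touched from below at `a₀` by the affine function of slope `p`, and from above to
first order in the direction `v`, has a derivative close to `p` at a point near `a₀ + s • v`. -/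
theorem exists_norm_fderiv_sub_le {E : Type*} [NormedAddCommGroup E] [InnerProductSpace ℝ E]
    [FiniteDimensional ℝ E] {f : E → ℝ} {a₀ v : E} (hv : ‖v‖ = 1) {p : E →L[ℝ] ℝ} {ε s : ℝ}
    (hε : 0 < ε) (hs : 0 < s)
    (hdiff : ∀ a ∈ Metric.closedBall (a₀ + s • v) (s / 2), DifferentiableAt ℝ f a)
    (hlow : ∀ a ∈ Metric.closedBall (a₀ + s • v) (s / 2),
      f a₀ + p (a - a₀) - ε * ‖a - a₀‖ ≤ f a)
    (hup : f (a₀ + s • v) ≤ f a₀ + s * p v + s * ε) :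
    ∃ a ∈ Metric.ball (a₀ + s • v) (s / 2), ‖fderiv ℝ f a - p‖ ≤ 12 * ε := by
  set b := a₀ + s • v with hb
  -- On the boundary sphere the penalty is 3εs, more than the error 3εs/2 of the lower bound plus εs
  -- of the upper bound, so the minimum is interior. There the gradient of the penalty has norm at
  -- most κs = 12ε.
  set κ := 12 * ε / s with hκ
  have hκ0 : 0 < κ := by positivity
  set h : E → ℝ := fun a => f a - p a + κ * ‖a - b‖ ^ 2 with hh
  have hcont : ContinuousOn h (Metric.closedBall b (s / 2)) := by
    have h1 : ContinuousOn f (Metric.closedBall b (s / 2)) :=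
      fun a ha => (hdiff a ha).continuousAt.continuousWithinAt
    exact (h1.sub p.continuous.continuousOn).add (by fun_prop)
  have hbm : b ∈ Metric.closedBall b (s / 2) := Metric.mem_closedBall_self (by positivity)
  obtain ⟨a, ha, hmin⟩ := (isCompact_closedBall b (s / 2)).exists_isMinOn ⟨b, hbm⟩ hcont
  have hab : ‖a - b‖ ≤ s / 2 := by simpa [dist_eq_norm] using ha
  have hlt : ‖a - b‖ < s / 2 := by
    refine lt_of_le_of_ne hab fun heq => ?_
    have h1 : h a ≤ h b := hmin hbm
    have h2 := hlow a ha
    have h3 : ‖a - a₀‖ ≤ 3 / 2 * s := by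
      have h4 : a - a₀ = (a - b) + s • v := by rw [hb]; abel
      rw [h4]
      refine (norm_add_le _ _).trans ?_
      rw [norm_smul, hv, Real.norm_of_nonneg hs.le]
      linarith
    have h5 : κ * ‖a - b‖ ^ 2 = 3 * ε * s := by rw [heq, hκ]; field_simp; ring
    simp only [hh, h5, sub_self, norm_zero] at h1
    have h6 : p b = p a₀ + s * p v := by simp [hb]
    rw [map_sub] at h2
    have h7 : ε * ‖a - a₀‖ ≤ ε * (3 / 2 * s) := by gcongr
    have h8 : 0 < ε * s := by positivity
    nlinarith
  refine ⟨a, by simpa [dist_eq_norm] using hlt, ?_⟩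
  have hloc : IsLocalMin h a :=
    hmin.isLocalMin (mem_of_superset (Metric.isOpen_ball.mem_nhds
      (by simpa [dist_eq_norm] using hlt)) Metric.ball_subset_closedBall)
  have hd1 := (hdiff a ha).hasFDerivAt
  have hd2 : HasFDerivAt (fun x => ‖x - b‖ ^ 2) (2 • (innerSL ℝ (a - b))) a := by
    have := ((hasFDerivAt_id a).sub_const b).norm_sq
    simpa using this
  have hd3 : HasFDerivAt h (fderiv ℝ f a - p + κ • (2 • innerSL ℝ (a - b))) a :=
    (hd1.sub p.hasFDerivAt).add (hd2.const_mul κ)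
  have h0 := hloc.hasFDerivAt_eq_zero hd3
  rw [eq_neg_of_add_eq_zero_left h0, norm_neg, norm_smul, Real.norm_of_nonneg hκ0.le]
  have hn : ‖(2 : ℕ) • innerSL ℝ (a - b)‖ ≤ 2 * ‖a - b‖ := by
    refine (norm_nsmul_le).trans ?_
    simp [-map_sub]
  calc κ * ‖(2 : ℕ) • innerSL ℝ (a - b)‖ ≤ κ * (2 * (s / 2)) := by gcongr; linarith
    _ = 12 * ε := by rw [hκ]; field_simp

/-! ### Limits of foci at an isolated singular point -/

section PuncturedNeighborhood

variable (n : ℕ) {M N : Type*}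
  [TopologicalSpace M] [ChartedSpace (EuclideanSpace ℝ (Fin n)) M]
  [TopologicalSpace N] [ChartedSpace (EuclideanSpace ℝ (Fin n)) N]

/-- The function `u` is differentiable at all points close to, but different from `x₀`, and has
there supporting functions with foci in the compact set `S`. -/
structure IsPuncturedSupported (c : M → N → ℝ) (Ω : Set M) (Ω' : Set N) (D : Set M) (u : M → ℝ)
    (x₀ : M) (S : Set N) : Prop where
  cost : CostC1 n c Ω Ω'
  isOpen_source : IsOpen Ω
  isOpen_target : IsOpen Ω'
  subset_source : D ⊆ Ω
  mem_interior : x₀ ∈ interior D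
  isCompact : IsCompact S
  subset_target : S ⊆ Ω'
  exists_mem : ∃ y ∈ Ω', y ∈ cSubdiff c D u x₀
  eventually : ∀ᶠ x in 𝓝[≠] x₀, x ∈ interior D ∧ MDifferentiableAt (𝓡 n) 𝓘(ℝ, ℝ) u x ∧
    ∃ y ∈ S, y ∈ cSubdiff c D u x

namespace IsPuncturedSupported

variable {n} {c : M → N → ℝ} {Ω : Set M} {Ω' : Set N} {D : Set M} {u : M → ℝ}
  {x₀ : M} {S : Set N}

theorem mem_source (h : IsPuncturedSupported n c Ω Ω' D u x₀ S) : x₀ ∈ Ω :=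
  h.subset_source (interior_subset h.mem_interior)

/-- Continuity of u is not needed: a supporting function at x₀ bounds u (x i) from below by a
quantity tending to u x₀. -/
theorem mem_cSubdiff_of_tendsto (h : IsPuncturedSupported n c Ω Ω' D u x₀ S) {ι : Type*}
    {l : Filter ι} [l.NeBot] {x : ι → M} {y : ι → N} {y₁ : N} (hx : Tendsto x l (𝓝 x₀))
    (hy : Tendsto y l (𝓝 y₁)) (hy₁ : y₁ ∈ Ω') (hsub : ∀ i, y i ∈ cSubdiff c D u (x i)) :
    y₁ ∈ cSubdiff c D u x₀ := by
  intro x' hx'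
  obtain ⟨y₀, hy₀, hsub₀⟩ := h.exists_mem
  have hc : ∀ {z : ι → M} {w : ι → N} {z₁ : M} {w₁ : N}, Tendsto z l (𝓝 z₁) →
      Tendsto w l (𝓝 w₁) → z₁ ∈ Ω → w₁ ∈ Ω' →
      Tendsto (fun i => c (z i) (w i)) l (𝓝 (c z₁ w₁)) := fun hz hw hz₁ hw₁ =>
    (h.cost.continuousAt h.isOpen_source h.isOpen_target hz₁ hw₁).tendsto.comp
      (hz.prodMk_nhds hw)
  have h1 : Tendsto (fun i => (u x₀ + c x₀ y₀ - c (x i) y₀) + c (x i) (y i)) l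
      (𝓝 ((u x₀ + c x₀ y₀ - c x₀ y₀) + c x₀ y₁)) :=
    (tendsto_const_nhds.sub (hc hx tendsto_const_nhds h.mem_source hy₀)).add
      (hc hx hy h.mem_source hy₁)
  have h2 : Tendsto (fun i => u x' + c x' (y i)) l (𝓝 (u x' + c x' y₁)) :=
    tendsto_const_nhds.add (hc tendsto_const_nhds hy (h.subset_source hx') hy₁)
  have h3 := le_of_tendsto_of_tendsto h1 h2 (by
    filter_upwards [hx.eventually (mem_interior_iff_mem_nhds.1 h.mem_interior)] with i hi
    have := hsub i x' hx'
    have := hsub₀ (x i) hi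
    linarith)
  simpa using h3

theorem negD_mem_subdiff (h : IsPuncturedSupported n c Ω Ω' D u x₀ S) {y : N} (hy : y ∈ Ω')
    (hsub : y ∈ cSubdiff c D u x₀) : negD n c x₀ y ∈ subdiff n u x₀ := by
  intro ε hε
  obtain ⟨s, hs, V, hV, hexp⟩ :=
    h.cost.exists_nhds_expansion h.isOpen_source h.isOpen_target h.mem_source hy hε
  filter_upwards [(continuousAt_extChartAt (I := 𝓡 n) x₀).preimage_mem_nhds hs,
    extChartAt_source_mem_nhds (I := 𝓡 n) x₀, mem_interior_iff_mem_nhds.1 h.mem_interior]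
    with x hxs hxφ hxD
  have h1 := hexp _ hxs _ (mem_of_mem_nhds hs) y (mem_of_mem_nhds hV)
  rw [(extChartAt (𝓡 n) x₀).left_inv hxφ, extChartAt_to_inv] at h1
  have h2 := (abs_le.1 h1).2
  have h3 := hsub x hxD
  linarith

theorem tendsto_ray (x₀ : M) (v : EuclideanSpace ℝ (Fin n)) :
    Tendsto (fun s : ℝ => (extChartAt (𝓡 n) x₀).symm (extChartAt (𝓡 n) x₀ x₀ + s • v)) (𝓝 0)
      (𝓝 x₀) := by
  refine (tendsto_extChartAt_symm x₀).comp ?_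
  have : Continuous fun s : ℝ => extChartAt (𝓡 n) x₀ x₀ + s • v := by fun_prop
  simpa using this.tendsto 0

theorem extChartAt_symm_ne {a : EuclideanSpace ℝ (Fin n)}
    (ha : a ∈ (extChartAt (𝓡 n) x₀).target) (hne : a ≠ extChartAt (𝓡 n) x₀ x₀) :
    (extChartAt (𝓡 n) x₀).symm a ≠ x₀ := by
  intro heq
  apply hne
  rw [← (extChartAt (𝓡 n) x₀).right_inv ha, heq]

/-- Points close to the centre in the chart, and different from it, have the properties required
in `IsPuncturedSupported`. -/
theorem eventually_chart (h : IsPuncturedSupported n c Ω Ω' D u x₀ S) :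
    ∀ᶠ a in 𝓝 (extChartAt (𝓡 n) x₀ x₀), a ∈ (extChartAt (𝓡 n) x₀).target ∧
      (a ≠ extChartAt (𝓡 n) x₀ x₀ →
        (extChartAt (𝓡 n) x₀).symm a ∈ interior D ∧
        MDifferentiableAt (𝓡 n) 𝓘(ℝ, ℝ) u ((extChartAt (𝓡 n) x₀).symm a) ∧
        ∃ y ∈ S, y ∈ cSubdiff c D u ((extChartAt (𝓡 n) x₀).symm a)) := by
  have h1 := (tendsto_extChartAt_symm (n := n) x₀).eventually (eventually_nhdsWithin_iff.1 h.eventually)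
  filter_upwards [h1, extChartAt_target_mem_nhds (I := 𝓡 n) x₀] with a ha hat
  exact ⟨hat, fun hne => ha (extChartAt_symm_ne hat hne)⟩

variable [FirstCountableTopology N]

/-- First order upper bound along rays. -/
theorem exists_frequently_le (h : IsPuncturedSupported n c Ω Ω' D u x₀ S)
    {v : EuclideanSpace ℝ (Fin n)} (hv : v ≠ 0) :
    ∃ y₁ ∈ S, y₁ ∈ cSubdiff c D u x₀ ∧ ∀ ε > 0, ∃ᶠ s in 𝓝[>] (0 : ℝ),
      u ((extChartAt (𝓡 n) x₀).symm (extChartAt (𝓡 n) x₀ x₀ + s • v)) ≤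
        u x₀ + s * negD n c x₀ y₁ v + s * ε := by
  set φ := extChartAt (𝓡 n) x₀ with hφ
  have hcr : Continuous fun s : ℝ => φ x₀ + s • v := by fun_prop
  have htr : Tendsto (fun s : ℝ => φ x₀ + s • v) (𝓝 0) (𝓝 (φ x₀)) := by
    simpa using hcr.tendsto 0
  have hex : ∀ k : ℕ, ∃ s : ℝ, 0 < s ∧ s < 1 / ((k : ℝ) + 1) ∧
      ∃ y ∈ S, y ∈ cSubdiff c D u (φ.symm (φ x₀ + s • v)) := by
    intro k
    have hk : (0 : ℝ) < 1 / ((k : ℝ) + 1) := by positivity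
    have h1 := (htr.eventually h.eventually_chart).filter_mono
      (nhdsWithin_le_nhds (s := Ioi (0 : ℝ)))
    obtain ⟨s, hs, hs'⟩ := (h1.and (Ioo_mem_nhdsGT hk)).exists
    refine ⟨s, hs'.1, hs'.2, (hs.2 ?_).2.2⟩
    rw [Ne, ← hφ, add_eq_left]
    exact smul_ne_zero hs'.1.ne' hv
  choose s hs0 hs1 y hyS hy using hex
  obtain ⟨y₁, hy₁, σ, hσ, hlim⟩ := h.isCompact.tendsto_subseq hyS
  have hst : Tendsto (s ∘ σ) atTop (𝓝 0) :=
    (squeeze_zero (fun k => (hs0 k).le) (fun k => (hs1 k).le)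
      tendsto_one_div_add_atTop_nhds_zero_nat).comp hσ.tendsto_atTop
  refine ⟨y₁, hy₁, ?_, fun ε hε => ?_⟩
  · exact h.mem_cSubdiff_of_tendsto ((tendsto_ray x₀ v).comp hst) hlim
      (h.subset_target hy₁) (fun k => hy (σ k))
  · obtain ⟨t, ht, V, hV, hexp⟩ := h.cost.exists_nhds_expansion h.isOpen_source h.isOpen_target
      h.mem_source (h.subset_target hy₁) (ε := ε / ‖v‖) (div_pos hε (norm_pos_iff.2 hv))
    have hst' : Tendsto (s ∘ σ) atTop (𝓝[>] 0) :=
      tendsto_nhdsWithin_iff.2 ⟨hst, Eventually.of_forall fun k => hs0 _⟩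
    refine hst'.frequently (Eventually.frequently ?_)
    filter_upwards [(htr.comp hst).eventually ht, hlim.eventually hV] with k hkt hkV
    have h1 := hexp _ hkt _ (mem_of_mem_nhds ht) _ hkV
    simp only [← hφ, Function.comp_apply, add_sub_cancel_left, map_smul, smul_eq_mul] at h1
    rw [hφ, extChartAt_to_inv, ← hφ, norm_smul, Real.norm_of_nonneg (hs0 _).le] at h1
    have h2 := (abs_le.1 h1).1
    -- The support inequality at the nearby point, evaluated at x₀, becomes an upper bound for u at
    -- the nearby point. It holds only frequently in s because the foci converge along a
    -- subsequence.
    have h3 := hy (σ k) x₀ (interior_subset h.mem_interior)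
    have h4 : ε / ‖v‖ * (s (σ k) * ‖v‖) = s (σ k) * ε := by
      have := norm_ne_zero_iff.2 hv
      field_simp
    rw [h4] at h2
    simp only [Function.comp_apply]
    linarith

theorem eventually_le_chart {p : Covec n} (hp : p ∈ subdiff n u x₀) {ε : ℝ} (hε : 0 < ε) :
    ∀ᶠ a in 𝓝 (extChartAt (𝓡 n) x₀ x₀), u x₀ + p (a - extChartAt (𝓡 n) x₀ x₀)
      - ε * ‖a - extChartAt (𝓡 n) x₀ x₀‖ ≤ u ((extChartAt (𝓡 n) x₀).symm a) := by
  filter_upwards [(tendsto_extChartAt_symm x₀).eventually (hp ε hε),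
    extChartAt_target_mem_nhds (I := 𝓡 n) x₀] with a ha hat
  rwa [(extChartAt (𝓡 n) x₀).right_inv hat] at ha

/-- Subgradients bound u from below along the ray and the limit focus bounds it from above;
comparing slopes at a common small s shows that the limit focus realizes the maximum of v over the
subdifferential. -/
theorem exists_forall_subdiff_le (h : IsPuncturedSupported n c Ω Ω' D u x₀ S)
    {v : EuclideanSpace ℝ (Fin n)} (hv : v ≠ 0) :
    ∃ y₁ ∈ S, y₁ ∈ cSubdiff c D u x₀ ∧ (∀ p ∈ subdiff n u x₀, p v ≤ negD n c x₀ y₁ v) ∧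
      ∀ ε > 0, ∃ᶠ s in 𝓝[>] (0 : ℝ),
      u ((extChartAt (𝓡 n) x₀).symm (extChartAt (𝓡 n) x₀ x₀ + s • v)) ≤
        u x₀ + s * negD n c x₀ y₁ v + s * ε := by
  obtain ⟨y₁, hy₁, hsub, hfr⟩ := h.exists_frequently_le hv
  refine ⟨y₁, hy₁, hsub, fun p hp => le_of_forall_pos_le_add fun ε hε => ?_, hfr⟩
  have hcr : Continuous fun s : ℝ => extChartAt (𝓡 n) x₀ x₀ + s • v := by fun_prop
  have htr : Tendsto (fun s : ℝ => extChartAt (𝓡 n) x₀ x₀ + s • v) (𝓝[>] 0)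
      (𝓝 (extChartAt (𝓡 n) x₀ x₀)) := by
    have := (hcr.tendsto 0).mono_left (nhdsWithin_le_nhds (s := Ioi (0 : ℝ)))
    simpa using this
  have hv' := norm_pos_iff.2 hv
  obtain ⟨s, hs1, hs2, hs0⟩ := ((hfr (ε / 2) (half_pos hε)).and_eventually
    ((htr.eventually (eventually_le_chart hp (ε := ε / 2 / ‖v‖) (by positivity))).and
      self_mem_nhdsWithin)).exists
  have hs0' : 0 < s := hs0
  simp only [add_sub_cancel_left, map_smul, smul_eq_mul, norm_smul,
    Real.norm_of_nonneg hs0'.le] at hs2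
  have h4 : ε / 2 / ‖v‖ * (s * ‖v‖) = s * (ε / 2) := by field_simp
  rw [h4] at hs2
  have h5 : s * p v ≤ s * (negD n c x₀ y₁ v + ε) := by linarith
  exact le_of_mul_le_mul_left h5 hs0'

/-- In each direction the support function is bounded by the value of some -Dc(x₀, y) with y in the
compact set S. -/
theorem isBounded_subdiff (h : IsPuncturedSupported n c Ω Ω' D u x₀ S) :
    Bornology.IsBounded (subdiff n u x₀) := by
  obtain ⟨C, hC⟩ := h.isCompact.exists_bound_of_continuousOn
    ((h.cost.continuousOn_negD h.isOpen_source h.isOpen_target h.mem_source).mono h.subset_target)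
  refine isBounded_iff_forall_norm_le.2 ⟨|C|, fun p hp => ?_⟩
  have hle : ∀ v, p v ≤ |C| * ‖v‖ := by
    intro v
    rcases eq_or_ne v 0 with rfl | hv
    · simp
    obtain ⟨y₁, hy₁, -, hle, -⟩ := h.exists_forall_subdiff_le hv
    calc p v ≤ negD n c x₀ y₁ v := hle p hp
      _ ≤ ‖negD n c x₀ y₁ v‖ := Real.le_norm_self _
      _ ≤ ‖negD n c x₀ y₁‖ * ‖v‖ := ContinuousLinearMap.le_opNorm _ _
      _ ≤ |C| * ‖v‖ := by gcongr; exact (hC y₁ hy₁).trans (le_abs_self C)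
  refine p.opNorm_le_bound (abs_nonneg C) fun v => ?_
  refine abs_le.2 ⟨?_, hle v⟩
  have := hle (-v)
  rw [map_neg, norm_neg] at this
  linarith

/-- Points of the subdifferential which maximize a nontrivial linear functional are attained by
the foci of supporting functions. -/
theorem exists_negD_eq [IsManifold (𝓡 n) ∞ M] (h : IsPuncturedSupported n c Ω Ω' D u x₀ S)
    {p : Covec n} (hp : p ∈ subdiff n u x₀) {v : EuclideanSpace ℝ (Fin n)} (hv : ‖v‖ = 1)
    (hmax : ∀ q ∈ subdiff n u x₀, q v ≤ p v) :
    ∃ y ∈ S, y ∈ cSubdiff c D u x₀ ∧ negD n c x₀ y = p := by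
  set φ := extChartAt (𝓡 n) x₀ with hφ
  have hv0 : v ≠ 0 := by rintro rfl; simp at hv
  obtain ⟨y₀, hy₀S, hy₀, hle, hfr⟩ := h.exists_forall_subdiff_le hv0
  have heq : negD n c x₀ y₀ v = p v :=
    le_antisymm (hmax _ (h.negD_mem_subdiff (h.subset_target hy₀S) hy₀)) (hle p hp)
  rw [heq] at hfr
  have hex : ∀ k : ℕ, ∃ a, dist a (φ x₀) < 1 / ((k : ℝ) + 1) ∧ a ∈ φ.target ∧
      φ.symm a ∈ interior D ∧ MDifferentiableAt (𝓡 n) 𝓘(ℝ, ℝ) u (φ.symm a) ∧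
      ‖fderiv ℝ (fun a => u (φ.symm a)) a - p‖ ≤ 12 * (1 / ((k : ℝ) + 1)) ∧
      ∃ y ∈ S, y ∈ cSubdiff c D u (φ.symm a) := by
    intro k
    set ε : ℝ := 1 / ((k : ℝ) + 1) with hε
    have hε0 : 0 < ε := by positivity
    obtain ⟨r, hr, hball⟩ := Metric.eventually_nhds_iff.1
      (h.eventually_chart.and (eventually_le_chart hp hε0))
    have hδ : 0 < min r ε / 2 := by positivity
    obtain ⟨s, hs, hs0, hs1⟩ := ((hfr ε hε0).and_eventually (Ioo_mem_nhdsGT hδ)).exists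
    -- Radius s/2 keeps the ball away from the singular point, so u is differentiable on all of it.
    have hdist : ∀ a ∈ Metric.closedBall (φ x₀ + s • v) (s / 2),
        dist a (φ x₀) < min r ε ∧ a ≠ φ x₀ := by
      intro a ha
      have hsn : dist (φ x₀ + s • v) (φ x₀) = s := by
        rw [dist_eq_norm, add_sub_cancel_left, norm_smul, hv, mul_one, Real.norm_of_nonneg hs0.le]
      have ha' := Metric.mem_closedBall.1 ha
      refine ⟨?_, ?_⟩
      · have := dist_triangle a (φ x₀ + s • v) (φ x₀)
        linarith
      · rintro rfl
        rw [dist_comm, hsn] at ha'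
        linarith
    have hprop := fun a ha => hball ((hdist a ha).1.trans_le (min_le_left _ _))
    obtain ⟨a, ha, hder⟩ := exists_norm_fderiv_sub_le (f := fun a => u (φ.symm a)) hv hε0 hs0
      (p := p) (fun a ha => differentiableAt_comp_extChartAt_symm (hprop a ha).1.1
        ((hprop a ha).1.2 (hdist a ha).2).2.1)
      (fun a ha => by simpa only [hφ, extChartAt_to_inv] using (hprop a ha).2)
      (by simpa only [hφ, extChartAt_to_inv] using hs)
    have ha' := Metric.ball_subset_closedBall ha
    obtain ⟨h1, h2, h3⟩ := (hprop a ha').1.2 (hdist a ha').2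
    exact ⟨a, (hdist a ha').1.trans_le (min_le_right _ _), (hprop a ha').1.1, h1, h2, hder, h3⟩
  choose a had hat haD hau hader y hyS hy using hex
  obtain ⟨y₁, hy₁, σ, hσ, hlim⟩ := h.isCompact.tendsto_subseq hyS
  have hone : Tendsto (fun k => 1 / ((σ k : ℝ) + 1)) atTop (𝓝 0) :=
    tendsto_one_div_add_atTop_nhds_zero_nat.comp hσ.tendsto_atTop
  have halim : Tendsto (a ∘ σ) atTop (𝓝 (φ x₀)) :=
    tendsto_iff_dist_tendsto_zero.2
      (squeeze_zero (fun _ => dist_nonneg) (fun k => (had (σ k)).le) hone)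
  refine ⟨y₁, hy₁, h.mem_cSubdiff_of_tendsto ((tendsto_extChartAt_symm x₀).comp halim) hlim
    (h.subset_target hy₁) (fun k => hy (σ k)), ?_⟩
  refine eq_of_forall_dist_le fun ε hε => ?_
  obtain ⟨t, ht, V, hV, hexp⟩ := h.cost.exists_nhds_expansion h.isOpen_source h.isOpen_target
    h.mem_source (h.subset_target hy₁) (half_pos hε)
  have hone' : Tendsto (fun k => 12 * (1 / ((σ k : ℝ) + 1))) atTop (𝓝 0) := by
    simpa using hone.const_mul 12
  obtain ⟨k, hk1, hk2, hk3⟩ := ((halim.eventually (eventually_mem_nhds_iff.2 ht)).and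
    ((hlim.eventually hV).and (hone'.eventually (ge_mem_nhds (half_pos hε))))).exists
  simp only [Function.comp_apply] at hk1 hk2
  have hyΩ : y (σ k) ∈ Ω' := h.subset_target (hyS _)
  have hD1 := (differentiableAt_comp_extChartAt_symm (hat (σ k)) (hau (σ k))).hasFDerivAt
  have hD2 := (differentiableAt_comp_extChartAt_symm (hat (σ k)) (h.cost.mdifferentiableAt_fst
    h.isOpen_source h.isOpen_target (h.subset_source (interior_subset (haD (σ k))))
    hyΩ)).hasFDerivAt
  rw [← hφ] at hD1 hD2
  set ℓ := fderiv ℝ (fun b => c (φ.symm b) (y (σ k))) (a (σ k)) with hℓ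
  have hmin : IsLocalMin ((fun b => u (φ.symm b)) + fun b => c (φ.symm b) (y (σ k)))
      (a (σ k)) := by
    have hcs : ContinuousAt φ.symm (a (σ k)) := continuousAt_extChartAt_symm'' (hat (σ k))
    filter_upwards [hcs.preimage_mem_nhds (mem_interior_iff_mem_nhds.1 (haD (σ k)))] with b hb
    exact hy (σ k) _ hb
  -- Both derivatives are taken in the chart at x₀, so they can be compared with covectors at x₀
  -- although the base point is a nearby one.
  have hsum : fderiv ℝ (fun b => u (φ.symm b)) (a (σ k)) = -ℓ :=
    eq_neg_of_add_eq_zero_left (hmin.hasFDerivAt_eq_zero (hD1.add hD2))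
  have hn : ‖ℓ + negD n c x₀ y₁‖ ≤ ε / 2 :=
    (hD2.add (negD n c x₀ y₁).hasFDerivAt).le_of_lip' (half_pos hε).le (by
      filter_upwards [hk1] with b hb
      have := hexp b hb _ (mem_of_mem_nhds hk1) _ hk2
      rw [map_sub] at this
      refine le_of_eq_of_le (congrArg norm ?_) this
      exact add_sub_add_comm _ _ _ _)
  have hd := hader (σ k)
  rw [hsum] at hd
  calc dist (negD n c x₀ y₁) p = ‖(ℓ + negD n c x₀ y₁) + (-ℓ - p)‖ := by
        rw [dist_eq_norm]; congr 1; abel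
    _ ≤ ‖ℓ + negD n c x₀ y₁‖ + ‖-ℓ - p‖ := norm_add_le _ _
    _ ≤ ε := by linarith

end IsPuncturedSupported

end PuncturedNeighborhood

/-! ### Convex geometry of the subdifferential -/

section Subdifferential

variable {n : ℕ} {M : Type*} [TopologicalSpace M]
  [ChartedSpace (EuclideanSpace ℝ (Fin n)) M] {u : M → ℝ} {x : M}

theorem convex_subdiff : Convex ℝ (subdiff n u x) := by
  intro p hp q hq a b ha hb hab ε hε
  filter_upwards [hp ε hε, hq ε hε] with y h1 h2
  set w := extChartAt (𝓡 n) x y - extChartAt (𝓡 n) x x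
  have h3 : (a • p + b • q) w = a * p w + b * q w := rfl
  rw [h3]
  have h4 := mul_le_mul_of_nonneg_left h1 ha
  have h5 := mul_le_mul_of_nonneg_left h2 hb
  have h6 : ∀ t : ℝ, t = a * t + b * t := fun t => by rw [← add_mul, hab, one_mul]
  rw [h6 (u y), h6 (u x), h6 (ε * ‖w‖)]
  linarith

theorem isClosed_subdiff : IsClosed (subdiff n u x) := by
  refine isClosed_of_closure_subset fun p hp ε hε => ?_
  obtain ⟨q, hq, hpq⟩ := Metric.mem_closure_iff.1 hp (ε / 2) (half_pos hε)
  filter_upwards [hq (ε / 2) (half_pos hε)] with y hy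
  set w := extChartAt (𝓡 n) x y - extChartAt (𝓡 n) x x
  have h1 : (p - q) w ≤ ε / 2 * ‖w‖ := by
    refine (Real.le_norm_self _).trans ((ContinuousLinearMap.le_opNorm _ _).trans ?_)
    rw [dist_eq_norm] at hpq
    gcongr
  rw [sub_apply] at h1
  linarith

theorem finrank_covec (n : ℕ) : Module.finrank ℝ (Covec n) = n := by
  rw [← (LinearMap.toContinuousLinearMap (𝕜 := ℝ) (E := EuclideanSpace ℝ (Fin n))
    (F' := ℝ)).finrank_eq]
  simp

/-- The condition n ≠ 0 excludes the empty set, whose `affDim` is 0. -/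
theorem interior_nonempty_of_affDim {K : Set (Covec n)} (hn : n ≠ 0) (hK : Convex ℝ K)
    (hdim : affDim K = n) : (interior K).Nonempty := by
  have hne : K.Nonempty := by
    by_contra h
    rw [not_nonempty_iff_eq_empty] at h
    rw [h, affDim, vectorSpan_empty, finrank_bot] at hdim
    exact hn hdim.symm
  rw [hK.interior_nonempty_iff_affineSpan_eq_top,
    AffineSubspace.affineSpan_eq_top_iff_vectorSpan_eq_top_of_nonempty ℝ _ _ hne]
  exact Submodule.eq_top_of_finrank_eq (hdim.trans (finrank_covec n).symm)

/-- Supporting hyperplanes of convex sets of covectors. -/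
theorem exists_norm_eq_one_forall_le {K : Set (Covec n)} (hK : Convex ℝ K)
    (hint : (interior K).Nonempty) {p : Covec n} (hp : p ∉ interior K) :
    ∃ v : EuclideanSpace ℝ (Fin n), ‖v‖ = 1 ∧ ∀ q ∈ K, q v ≤ p v := by
  obtain ⟨f, hf⟩ := geometric_hahn_banach_open_point hK.interior isOpen_interior hp
  let J := InnerProductSpace.toDual ℝ (EuclideanSpace ℝ (Fin n))
  let f' : Covec n := LinearMap.toContinuousLinearMap
    { toFun := fun v => f (J v)
      map_add' := fun a b => by simp
      map_smul' := fun r a => by simp }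
  -- A functional on covectors is evaluation at a vector; the Riesz isomorphism is used twice to
  -- produce it.
  let w := J.symm f'
  have hw : ∀ q : Covec n, f q = q w := by
    intro q
    have h1 : f q = f' (J.symm q) := by
      change f q = f (J (J.symm q))
      rw [J.apply_symm_apply]
    have h2 : q w = inner ℝ (J.symm q) w := by
      rw [InnerProductSpace.toDual_symm_apply]
    have h3 : f' (J.symm q) = inner ℝ w (J.symm q) := by
      rw [InnerProductSpace.toDual_symm_apply]
    rw [h1, h2, h3, real_inner_comm]
  have hle : ∀ q ∈ K, q w ≤ p w := by
    intro q hq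
    have h1 : q ∈ closure (interior K) := by
      rw [hK.closure_interior_eq_closure_of_nonempty_interior hint]
      exact subset_closure hq
    have h2 : closure (interior K) ⊆ {q | f q ≤ f p} :=
      closure_minimal (fun q hq => (hf q hq).le) (isClosed_le f.continuous continuous_const)
    have := h2 h1
    rwa [mem_ofPred_eq, hw, hw] at this
  have hw0 : w ≠ 0 := by
    obtain ⟨q, hq⟩ := hint
    intro h0
    have := hf q hq
    rw [hw, hw, h0, map_zero, map_zero] at this
    exact lt_irrefl _ this
  have hwn := norm_pos_iff.2 hw0
  refine ⟨‖w‖⁻¹ • w, by rw [norm_smul, norm_inv, norm_norm, inv_mul_cancel₀ hwn.ne'],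
    fun q hq => ?_⟩
  rw [map_smul, map_smul]
  exact mul_le_mul_of_nonneg_left (hle q hq) (by positivity)

/-- A convex set containing the boundary of a bounded closed set contains this set. -/
theorem subset_of_frontier_subset {F : Type*} [NormedAddCommGroup F] [NormedSpace ℝ F]
    [Nontrivial F] {K C : Set F} (hK : IsClosed K) (hKb : Bornology.IsBounded K)
    (hC : Convex ℝ C) (hKC : frontier K ⊆ C) : K ⊆ C := by
  intro p hp
  obtain ⟨e, he⟩ := exists_ne (0 : F)
  have hex : ∀ e : F, e ≠ 0 → ∃ t : ℝ, 0 ≤ t ∧ p + t • e ∈ frontier K := by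
    intro e he
    obtain ⟨R, hR⟩ := isBounded_iff_forall_norm_le.1 hKb
    have hen := norm_pos_iff.2 he
    set A := {t : ℝ | 0 ≤ t ∧ p + t • e ∈ K} with hA
    have hAc : IsClosed A :=
      (isClosed_Ici).inter (hK.preimage (by fun_prop : Continuous fun t : ℝ => p + t • e))
    have hA0 : (0 : ℝ) ∈ A := ⟨le_rfl, by simpa using hp⟩
    have hAb : BddAbove A := by
      refine ⟨(R + ‖p‖) / ‖e‖, fun t ht => ?_⟩
      rw [le_div_iff₀ hen]
      have h1 := hR _ ht.2
      have h2 : ‖t • e‖ ≤ ‖p + t • e‖ + ‖p‖ := by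
        have := norm_sub_le (p + t • e) p
        rwa [add_sub_cancel_left] at this
      rw [norm_smul, Real.norm_of_nonneg ht.1] at h2
      linarith
    -- The last time at which the ray is in K gives a boundary point. Doing this for e and -e
    -- exhibits p as a convex combination of two boundary points.
    have hm : sSup A ∈ A := hAc.csSup_mem ⟨0, hA0⟩ hAb
    refine ⟨sSup A, hm.1, subset_closure hm.2, fun hint => ?_⟩
    have hcont : Continuous fun t : ℝ => p + t • e := by fun_prop
    have h1 : ∀ᶠ t in 𝓝 (sSup A), p + t • e ∈ K :=
      hcont.continuousAt.eventually (mem_interior_iff_mem_nhds.1 hint)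
    obtain ⟨t, ht, hlt⟩ := ((h1.filter_mono nhdsWithin_le_nhds).and
      (self_mem_nhdsWithin : Ioi (sSup A) ∈ 𝓝[>] (sSup A))).exists
    exact absurd (le_csSup hAb ⟨hm.1.trans (le_of_lt hlt), ht⟩) (not_le.2 hlt)
  obtain ⟨t₁, ht₁, h₁⟩ := hex e he
  obtain ⟨t₂, ht₂, h₂⟩ := hex (-e) (neg_ne_zero.2 he)
  rcases ht₁.eq_or_lt with h0 | hpos
  · rw [← h0, zero_smul, add_zero] at h₁
    exact hKC h₁
  have hsum : 0 < t₁ + t₂ := by linarith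
  have := hC (hKC h₁) (hKC h₂) (a := t₂ / (t₁ + t₂)) (b := t₁ / (t₁ + t₂)) (by positivity)
    (by positivity) (by field_simp; ring)
  convert this using 1
  have h3 : t₂ / (t₁ + t₂) + t₁ / (t₁ + t₂) = 1 := by field_simp; ring
  calc p = (t₂ / (t₁ + t₂) + t₁ / (t₁ + t₂)) • p := by rw [h3, one_smul]
    _ = _ := by module

/-- On a zero-dimensional manifold every function is differentiable. -/
theorem mdifferentiableAt_of_subsingleton (hn : n = 0) : MDifferentiableAt (𝓡 n) 𝓘(ℝ, ℝ) u x := by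
  subst hn
  have hx : ∀ᶠ y in 𝓝 x, y = x := by
    filter_upwards [extChartAt_source_mem_nhds (I := 𝓡 0) x] with y hy
    exact (extChartAt (𝓡 0) x).injOn hy (mem_extChartAt_source x) (Subsingleton.elim _ _)
  exact (mdifferentiableAt_const (c := u x)).congr_of_eventuallyEq
    (hx.mono fun y hy => by rw [hy])

end Subdifferential

/-! ### The hole produced by an isolated singular point -/

section Brenier

variable {n : ℕ} {M : Type*} [TopologicalSpace M] [ChartedSpace (EuclideanSpace ℝ (Fin n)) M]
  {N : Type*} [EMetricSpace N] [ChartedSpace (EuclideanSpace ℝ (Fin n)) N]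
  {c : M → N → ℝ} {Ω : Set M} {Ω' : Set N} {D : Set M} {u : M → ℝ} {x₀ : M}

theorem CConvexFun.exists_mem_cSubdiff {M N : Type*} {c : M → N → ℝ} {Ω' : Set N} {D : Set M}
    {u : M → ℝ} (hu : CConvexFun c D Ω' u) {x : M} (hx : x ∈ D) :
    ∃ y ∈ Ω', y ∈ cSubdiff c D u x := by
  obtain ⟨y, hy, lam, h1, h2⟩ := hu x hx
  refine ⟨y, hy, fun x' hx' => ?_⟩
  have := h2 x' hx'
  linarith

/-- The Brenier map takes values in the `c`-subdifferential. -/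
theorem brenierMap_mem_cSubdiff [Nonempty N] (hc : CostC1 n c Ω Ω') (htw : Twist n c Ω Ω')
    (hΩ : IsOpen Ω) (hΩ' : IsOpen Ω') (hD : D ⊆ Ω) (hu : CConvexFun c D Ω' u) {x : M}
    (hx : x ∈ interior D) (hdiff : MDifferentiableAt (𝓡 n) 𝓘(ℝ, ℝ) u x) :
    brenierMap n c Ω' u x ∈ cSubdiff c D u x := by
  have hxD := interior_subset hx
  obtain ⟨y, hy, hsub⟩ := hu.exists_mem_cSubdiff hxD
  have h1 : diff n u x = negD n c x y := diff_eq_negD_of_isLocalMin hdiff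
    (hc.mdifferentiableAt_fst hΩ hΩ' (hD hxD) hy)
    (mem_of_superset (mem_interior_iff_mem_nhds.1 hx) hsub)
  have h2 : brenierMap n c Ω' u x = y := by
    rw [brenierMap, h1, cExp]
    exact (htw.1 x (hD hxD)).leftInvOn_invFunOn hy
  rwa [h2]

variable {S : Set N}

/-- A supporting hyperplane at a boundary point supplies the direction in which x₀ is approached. -/
theorem IsPuncturedSupported.frontier_subdiff_subset [IsManifold (𝓡 n) ∞ M]
    (h : IsPuncturedSupported n c Ω Ω' D u x₀ S) (hint : (interior (subdiff n u x₀)).Nonempty) :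
    frontier (subdiff n u x₀) ⊆ (fun y => negD n c x₀ y) '' (S ∩ cSubdiff c D u x₀) := by
  intro p hp
  obtain ⟨v, hv, hmax⟩ := exists_norm_eq_one_forall_le convex_subdiff hint hp.2
  obtain ⟨y, hyS, hy, rfl⟩ := h.exists_negD_eq (isClosed_subdiff.frontier_subset hp) hv hmax
  exact ⟨y, ⟨hyS, hy⟩, rfl⟩

/-- The `c`-exponential map is continuous. -/
theorem continuousOn_cExp [Nonempty N] (hc : CostC1 n c Ω Ω') (htw : Twist n c Ω Ω')
    (hΩ : IsOpen Ω) (hΩ' : IsOpen Ω') (hx₀ : x₀ ∈ Ω) :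
    ContinuousOn (cExp n c Ω' x₀) ((fun y => negD n c x₀ y) '' Ω') := by
  rintro _ ⟨y, hy, rfl⟩
  refine ContinuousAt.continuousWithinAt fun V hV => ?_
  have hinv : LeftInvOn (cExp n c Ω' x₀) (fun y => negD n c x₀ y) Ω' :=
    (htw.1 x₀ hx₀).leftInvOn_invFunOn
  rw [hinv hy] at hV
  rw [mem_map]
  -- Continuity of the inverse at a point is openness of the forward map there, that is, invariance
  -- of domain.
  refine mem_of_superset (image_mem_nhds_of_injOn (finrank_covec n) hΩ'
    (hc.continuousOn_negD hΩ hΩ' hx₀) (htw.1 x₀ hx₀) hy (inter_mem hV (hΩ'.mem_nhds hy))) ?_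
  rintro _ ⟨z, hz, rfl⟩
  change cExp n c Ω' x₀ (negD n c x₀ z) ∈ V
  exact (hinv hz.2).symm ▸ hz.1

/-- The foci of the interior of the subdifferential are not in the `c`-subdifferential at any
other point. -/
theorem IsPuncturedSupported.notMem_cSubdiff [IsManifold (𝓡 n) ∞ M] [Nonempty N]
    (h : IsPuncturedSupported n c Ω Ω' D u x₀ S) (htw : Twist n c Ω Ω')
    (hint : (interior (subdiff n u x₀)).Nonempty)
    (hK : subdiff n u x₀ ⊆ (fun y => negD n c x₀ y) '' Ω') {x : M} (hx : x ∈ D) (hne : x ≠ x₀)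
    {y : N} (hy : y ∈ Ω') (hyK : negD n c x₀ y ∈ interior (subdiff n u x₀)) :
    y ∉ cSubdiff c D u x := by
  intro hsub
  set K := subdiff n u x₀ with hKdef
  have hx₀ := h.mem_source
  have hinv : LeftInvOn (cExp n c Ω' x₀) (fun y => negD n c x₀ y) Ω' :=
    (htw.1 x₀ hx₀).leftInvOn_invFunOn
  have hcomp : IsCompact (cExp n c Ω' x₀ '' K) :=
    (Metric.isCompact_of_isClosed_isBounded isClosed_subdiff h.isBounded_subdiff).image_of_continuousOn
      ((continuousOn_cExp h.cost htw h.isOpen_source h.isOpen_target hx₀).mono hK)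
  have hsubΩ : ∀ z ∈ cExp n c Ω' x₀ '' K, z ∈ Ω' ∧ negD n c x₀ z ∈ K := by
    rintro _ ⟨p, hp, rfl⟩
    obtain ⟨z, hz, rfl⟩ := hK hp
    have h1 : cExp n c Ω' x₀ (negD n c x₀ z) = z := hinv hz
    simp only [h1]
    exact ⟨hz, hp⟩
  have hmem : ∀ z ∈ Ω', negD n c x₀ z ∈ K → z ∈ cExp n c Ω' x₀ '' K :=
    fun z hz hzK => ⟨_, hzK, hinv hz⟩
  have hcont : ∀ x' ∈ Ω, ContinuousOn (fun z => c x' z) (cExp n c Ω' x₀ '' K) := by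
    intro x' hx' z hz
    exact ContinuousAt.continuousWithinAt
      ((h.cost.continuousAt h.isOpen_source h.isOpen_target hx' (hsubΩ z hz).1).comp
        (f := fun z => (x', z)) (by fun_prop))
  set w : N → ℝ := fun z => c x z - c x₀ z with hw
  obtain ⟨z, hz, hmin⟩ := hcomp.exists_isMinOn ⟨y, hmem y hy (interior_subset hyK)⟩
    ((hcont x (h.subset_source hx)).sub (hcont x₀ hx₀))
  have hopen : IsOpen (Ω' ∩ (fun z => negD n c x₀ z) ⁻¹' interior K) :=
    (h.cost.continuousOn_negD h.isOpen_source h.isOpen_target hx₀).isOpen_inter_preimage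
      h.isOpen_target isOpen_interior
  -- Equality would make z' a local minimum of w, hence x = x₀ by the twist condition. So the
  -- minimizer z lies over the frontier.
  have hnot : ∀ z' ∈ Ω', negD n c x₀ z' ∈ interior K → w z < w z' := by
    intro z' hz' hzK'
    refine lt_of_le_of_ne (hmin (hmem z' hz' (interior_subset hzK'))) fun heq => hne ?_
    refine htw.eq_of_isLocalMin h.cost h.isOpen_source h.isOpen_target (h.subset_source hx) hx₀
      hz' ?_
    filter_upwards [hopen.mem_nhds ⟨hz', hzK'⟩] with z'' hz''
    change w z' ≤ w z''
    rw [← heq]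
    exact hmin (hmem z'' hz''.1 (interior_subset hz''.2))
  obtain ⟨hzΩ, hzK⟩ := hsubΩ z hz
  have hzf : negD n c x₀ z ∈ frontier K :=
    ⟨subset_closure hzK, fun hzi => lt_irrefl _ (hnot z hzΩ hzi)⟩
  obtain ⟨z₁, ⟨hz₁S, hz₁⟩, hzz⟩ := h.frontier_subdiff_subset hint hzf
  have hz₁z : z₁ = z := htw.1 x₀ hx₀ (h.subset_target hz₁S) hzΩ hzz
  rw [hz₁z] at hz₁
  -- Support at x₀ with focus z gives w z ≥ u x₀ - u x, and support at x with focus y gives w y ≤ u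
  -- x₀ - u x, against w z < w y.
  have h1 := hnot y hy hyK
  have h2 := hz₁ x hx
  have h3 := hsub x₀ (interior_subset h.mem_interior)
  simp only [hw] at h1
  linarith

/-- The foci of the interior of the subdifferential at an isolated singular point form a hole in
the support of the target measure. -/
theorem IsPuncturedSupported.isHole [IsManifold (𝓡 n) ∞ M] [Nonempty N] [MeasurableSpace M]
    [MeasurableSpace N] [BorelSpace N] {μ : Measure M} {ν : Measure N}
    (h : IsPuncturedSupported n c Ω Ω' D u x₀ ν.support) (htw : Twist n c Ω Ω')
    (hb : IsBoundedSet Ω') (hu : IsBrenierSolution n c D Ω' μ ν u)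
    (hsing : ¬ MDifferentiableAt (𝓡 n) 𝓘(ℝ, ℝ) u x₀)
    (hint : (interior (subdiff n u x₀)).Nonempty)
    (hK : interior (subdiff n u x₀) ⊆ (fun y => negD n c x₀ y) '' Ω') :
    ∃ O, IsHole ν.support O ∧ CConvexTarget n c Ω' x₀ O := by
  set K := subdiff n u x₀ with hKdef
  have hx₀ := h.mem_source
  have hfront := h.frontier_subdiff_subset hint
  have hKΩ : K ⊆ (fun y => negD n c x₀ y) '' Ω' := by
    intro p hp
    by_cases hpi : p ∈ interior K
    · exact hK hpi
    · obtain ⟨y, hy, hyp⟩ := hfront ⟨subset_closure hp, hpi⟩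
      exact ⟨y, h.subset_target hy.1, hyp⟩
  have hinv : LeftInvOn (cExp n c Ω' x₀) (fun y => negD n c x₀ y) Ω' :=
    (htw.1 x₀ hx₀).leftInvOn_invFunOn
  have hcE := continuousOn_cExp h.cost htw h.isOpen_source h.isOpen_target hx₀
  set O := Ω' ∩ (fun z => negD n c x₀ z) ⁻¹' interior K with hO
  have hopen : IsOpen O :=
    (h.cost.continuousOn_negD h.isOpen_source h.isOpen_target hx₀).isOpen_inter_preimage
      h.isOpen_target isOpen_interior
  have himg : (fun y => negD n c x₀ y) '' O = interior K := by
    refine Subset.antisymm ?_ fun p hp => ?_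
    · rintro _ ⟨y, hy, rfl⟩
      exact hy.2
    · obtain ⟨y, hy, rfl⟩ := hK hp
      exact ⟨y, ⟨hy, hp⟩, rfl⟩
  have himg' : cExp n c Ω' x₀ '' interior K = O := by
    rw [← himg, (hinv.mono inter_subset_left).image_image]
  -- Almost every x is a point of differentiability, hence differs from x₀, and its image under the
  -- Brenier map supports u at x.
  have hnull : ν O = 0 := by
    rw [← hu.map_eq, Measure.map_apply_of_aemeasurable hu.aemeasurable hopen.measurableSet]
    refine measure_eq_zero_iff_ae_notMem.2 ?_
    filter_upwards [hu.ae_differentiable] with x hx hxO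
    refine h.notMem_cSubdiff htw hint hKΩ (interior_subset hx.1) ?_ hxO.1 hxO.2
      (brenierMap_mem_cSubdiff h.cost htw h.isOpen_source h.isOpen_target h.subset_source
        hu.cConvex hx.1 hx.2)
    rintro rfl
    exact hsing hx.2
  have hdisj : O ⊆ ν.supportᶜ := Measure.subset_compl_support_of_isOpen hopen hnull
  -- Compactness of the image of K keeps the closure of O inside Ω', where -Dc(x₀, ·) is injective
  -- and boundary points of O correspond to boundary points of K.
  have hcl : closure O ⊆ cExp n c Ω' x₀ '' K := by
    refine closure_minimal ?_ (IsCompact.isClosed ?_)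
    · rw [← himg']
      exact image_mono interior_subset
    · exact (Metric.isCompact_of_isClosed_isBounded isClosed_subdiff
        h.isBounded_subdiff).image_of_continuousOn (hcE.mono hKΩ)
  have hconn : IsConnected O := by
    rw [← himg']
    exact (convex_subdiff.interior.isConnected hint).image _ (hcE.mono hK)
  refine ⟨O, ⟨hconn.nonempty, ?_, hopen, hconn, ?_, ?_⟩, inter_subset_left, ?_⟩
  · exact ne_top_of_le_ne_top hb (Metric.ediam_mono inter_subset_left)
  · exact eq_empty_of_forall_notMem fun y hy => hdisj hy.1 (interior_subset hy.2)
  · intro y hy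
    obtain ⟨p, hp, rfl⟩ := hcl hy.1
    obtain ⟨y, hyΩ, rfl⟩ := hKΩ hp
    have hyy : cExp n c Ω' x₀ (negD n c x₀ y) = y := hinv hyΩ
    simp only [hyy] at hy ⊢
    rw [hopen.frontier_eq] at hy
    have hpf : negD n c x₀ y ∈ frontier K :=
      ⟨subset_closure hp, fun hpi => hy.2 ⟨hyΩ, hpi⟩⟩
    obtain ⟨z, hz, hzy⟩ := hfront hpf
    have hzy' : z = y := htw.1 x₀ hx₀ (h.subset_target hz.1) hyΩ hzy
    refine ⟨subset_closure (hzy' ▸ hz.1), fun hyi => ?_⟩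
    have h1 : closure O ⊆ (interior ν.support)ᶜ :=
      closure_minimal (hdisj.trans (compl_subset_compl.2 interior_subset))
        isOpen_interior.isClosed_compl
    exact h1 hy.1 hyi
  · rw [himg]
    exact convex_subdiff.interior

/-- An isolated singular point in the interior of the support of the source measure. -/
theorem IsBrenierSolution.isPuncturedSupported [Nonempty N] [MeasurableSpace M]
    [MeasurableSpace N] {μ : Measure M} {ν : Measure N} (hu : IsBrenierSolution n c D Ω' μ ν u)
    (hc : CostC1 n c Ω Ω') (htw : Twist n c Ω Ω') (hΩ : IsOpen Ω) (hΩ' : IsOpen Ω') (hD : D ⊆ Ω)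
    (hν : ν.support ⊆ Ω') (hνc : IsCompact ν.support) (hx₀ : x₀ ∈ interior μ.support)
    (hsing : IsIsolatedSingularPoint n u x₀) :
    IsPuncturedSupported n c Ω Ω' D u x₀ ν.support where
  cost := hc
  isOpen_source := hΩ
  isOpen_target := hΩ'
  subset_source := hD
  mem_interior := interior_mono hu.support_subset hx₀
  isCompact := hνc
  subset_target := hν
  exists_mem := hu.cConvex.exists_mem_cSubdiff (hu.support_subset (interior_subset hx₀))
  eventually := by
    filter_upwards [hsing.2, nhdsWithin_le_nhds (isOpen_interior.mem_nhds hx₀)] with x hx hxμ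
    have hxD := interior_mono hu.support_subset hxμ
    exact ⟨hxD, hx, _, hu.mapsTo x (interior_subset hxμ) hxD hx,
      brenierMap_mem_cSubdiff hc htw hΩ hΩ' hD hu.cConvex hxD hx⟩

end Brenier

end OptTrans

theorem mainTheorem2 (n : ℕ)
    {M : Type*} [EMetricSpace M] [ChartedSpace (EuclideanSpace ℝ (Fin n)) M]
    [IsManifold (𝓡 n) ∞ M]
    [Bundle.RiemannianBundle (fun x : M => TangentSpace (𝓡 n) x)]
    [IsContMDiffRiemannianBundle (𝓡 n) ∞ (EuclideanSpace ℝ (Fin n))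
      (fun x : M => TangentSpace (𝓡 n) x)]
    [IsRiemannianManifold (𝓡 n) M]
    [MeasurableSpace M] [BorelSpace M]
    {N : Type*} [EMetricSpace N] [ChartedSpace (EuclideanSpace ℝ (Fin n)) N]
    [IsManifold (𝓡 n) ∞ N]
    [Bundle.RiemannianBundle (fun y : N => TangentSpace (𝓡 n) y)]
    [IsContMDiffRiemannianBundle (𝓡 n) ∞ (EuclideanSpace ℝ (Fin n))
      (fun y : N => TangentSpace (𝓡 n) y)]
    [IsRiemannianManifold (𝓡 n) N]
    [MeasurableSpace N] [BorelSpace N] [Nonempty N]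
    (Ω : Set M) (hΩ : OptTrans.IsDomainSet Ω) (hΩb : OptTrans.IsBoundedSet Ω)
    (Ω' : Set N) (hΩ' : OptTrans.IsDomainSet Ω') (hΩb' : OptTrans.IsBoundedSet Ω')
    (c : M → N → ℝ)
    (hc : OptTrans.CostC1 n c Ω Ω') (htwist : OptTrans.Twist n c Ω Ω')
    (μ : MeasureTheory.Measure M) [MeasureTheory.IsProbabilityMeasure μ]
    (ν : MeasureTheory.Measure N) [MeasureTheory.IsProbabilityMeasure ν]
    (hν : ν.support ⊆ Ω') (hνc : IsCompact ν.support)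
    (D : Set M) (hD : D ⊆ Ω) (u : M → ℝ)
    (hu : OptTrans.IsBrenierSolution n c D Ω' μ ν u) :
    ((¬ ∃ O : Set N, OptTrans.IsHole ν.support O) →
      ¬ ∃ x₀ ∈ interior μ.support,
        OptTrans.IsIsolatedSingularPoint n u x₀ ∧
        interior (OptTrans.subdiff n u x₀) ⊆ (fun y => OptTrans.negD n c x₀ y) '' Ω' ∧
        OptTrans.affDim (OptTrans.subdiff n u x₀) = n) ∧
    (OptTrans.CostA0 n c Ω Ω' → OptTrans.Nondegenerate n c Ω Ω' → OptTrans.MTW n c Ω Ω' →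
      OptTrans.MutuallyCConvex n c Ω Ω' →
      ¬ ∃ x₀ ∈ interior μ.support,
        (¬ ∃ O : Set N, OptTrans.IsHole ν.support O ∧ OptTrans.CConvexTarget n c Ω' x₀ O) ∧
        OptTrans.IsIsolatedSingularPoint n u x₀ ∧
        OptTrans.affDim (OptTrans.subdiff n u x₀) = n) := by
  have hn : ∀ x₀, OptTrans.IsIsolatedSingularPoint n u x₀ → n ≠ 0 := fun x₀ hx₀ h0 =>
    hx₀.1 (OptTrans.mdifferentiableAt_of_subsingleton h0)
  have key : ∀ x₀ ∈ interior μ.support, OptTrans.IsIsolatedSingularPoint n u x₀ →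
      OptTrans.IsPuncturedSupported n c Ω Ω' D u x₀ ν.support := fun x₀ hx₀ hsing =>
    hu.isPuncturedSupported hc htwist hΩ.1 hΩ'.1 hD hν hνc hx₀ hsing
  have hint : ∀ x₀, OptTrans.IsIsolatedSingularPoint n u x₀ →
      OptTrans.affDim (OptTrans.subdiff n u x₀) = n →
      (interior (OptTrans.subdiff n u x₀)).Nonempty := fun x₀ hsing hdim =>
    OptTrans.interior_nonempty_of_affDim (hn x₀ hsing) OptTrans.convex_subdiff hdim
  refine ⟨fun hhole => ?_, fun _ _ _ hconv => ?_⟩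
  · rintro ⟨x₀, hx₀, hsing, hK, hdim⟩
    obtain ⟨O, hO, -⟩ := (key x₀ hx₀ hsing).isHole htwist hΩb' hu hsing.1 (hint x₀ hsing hdim) hK
    exact hhole ⟨O, hO⟩
  · rintro ⟨x₀, hx₀, hhole, hsing, hdim⟩
    have h := key x₀ hx₀ hsing
    have hi := hint x₀ hsing hdim
    have : Nontrivial (OptTrans.Covec n) := Module.nontrivial_of_finrank_pos (R := ℝ) (by
      rw [OptTrans.finrank_covec]; exact Nat.pos_of_ne_zero (hn x₀ hsing))
    -- Convexity of -Dc(x₀, Ω') replaces the assumption of the first part that c-Exp is defined on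
    -- the interior of the subdifferential.
    have hK := OptTrans.subset_of_frontier_subset OptTrans.isClosed_subdiff h.isBounded_subdiff
      (hconv.2 x₀ h.mem_source).2
      ((h.frontier_subdiff_subset hi).trans (image_mono (inter_subset_left.trans hν)))
    exact hhole (h.isHole htwist hΩb' hu hsing.1 hi (interior_subset.trans hK))
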